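/- Let $\gamma>-\tfrac12$, let $\mu\ge 1$ be an integer, let $g$ be real analytic on (a neighbourhood of) $[-1,1]$, and let $$f_-(x)=(1-x)^\gamma\ln^\mu(1-x)\,g(x),\qquad f_+(x)=(1+x)^\gamma\ln^\mu(1+x)\,g(x),$$ with singular endpoint $e=1$ for $f_-$ and $e=-1$ for $f_+$. When $\gamma>0$, these functions take their limit value $0$ at the singular endpoint. For $f=f_\mp$ let $p_n^{I}$ and $p_n^{II}$ be the polynomials of degree at most $n$ that interpolate $f$ at the $n+1$ Chebyshev points of the first kind $\cos\frac{(2j+1)\pi}{2n+2}$, $0\le j\le n$, and of the second kind $\cos\frac{j\pi}{n}$, $0\le j\le n$ ($n\ge1$), respectively. Put $\lambda=\mu$ if $\gamma$ is not an integer and $\lambda=\mu-1$ if $\gamma$ is an integer. Then for each of $f=f_-$ and $f=f_+$, as $n\to\infty$: 1. for every fixed $x\in[-1,1]$ with $x\ne e$, $\;|f(x)-p_n^{I}(x)|=O\!\left(\dfrac{\ln^{\lambda}n}{n^{2\gamma+1}}\right)$; 2. if $\gamma>0$, then $\;|f(e)-p_n^{I}(e)|=O\!\left(\dfrac{\ln^{\lambda}n}{n^{2\gamma}}\right)$;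 3. if $\gamma>0$, then for every fixed $x\in[-1,1]$ with $x\ne e$, $\;|f(x)-p_n^{II}(x)|=O\!\left(\dfrac{\ln^{\lambda}n}{n^{2\gamma+1}}\right)$, and $\;|f(e)-p_n^{II}(e)|=O\!\left(\dfrac{\ln^{\lambda}n}{n^{2\gamma}}\right)$. The implied constants may depend on $\gamma,\mu,g$ and $x$, but not on $n$. -/

import Mathlib

namespace ChebInterp

/-- The function `(1 - x)^γ * ln^μ (1 - x) * g x`, with its singularity at `x = 1`.
For `0 < γ` and `1 ≤ μ` its value at `x = 1` is the limit value `0`. -/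
noncomputable def rightSing (γ : ℝ) (μ : ℕ) (g : ℝ → ℝ) (x : ℝ) : ℝ :=
  (1 - x) ^ γ * Real.log (1 - x) ^ μ * g x

/-- The function `(1 + x)^γ * ln^μ (1 + x) * g x`, with its singularity at `x = -1`. -/
noncomputable def leftSing (γ : ℝ) (μ : ℕ) (g : ℝ → ℝ) (x : ℝ) : ℝ :=
  (1 + x) ^ γ * Real.log (1 + x) ^ μ * g x

/-- The `j`-th of the `n + 1` Chebyshev points of the first kind, `0 ≤ j ≤ n`. -/
noncomputable def firstNode (n j : ℕ) : ℝ :=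
  Real.cos ((2 * (j : ℝ) + 1) / (2 * (n : ℝ) + 2) * Real.pi)

/-- The polynomial of degree at most `n` interpolating `f` at the `n + 1` Chebyshev points of the
first kind. -/
noncomputable def firstInterp (f : ℝ → ℝ) (n : ℕ) : Polynomial ℝ :=
  Lagrange.interpolate (Finset.range (n + 1)) (firstNode n) (fun j => f (firstNode n j))

/-- The polynomial of degree at most `n` interpolating `f` at the `n + 1` Chebyshev points of the
second kind `Polynomial.Chebyshev.node n j = cos (j * π / n)`, `0 ≤ j ≤ n` (for `n ≥ 1`). -/
noncomputable def secondInterp (f : ℝ → ℝ) (n : ℕ) : Polynomial ℝ :=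
  Lagrange.interpolate (Finset.range (n + 1)) (Polynomial.Chebyshev.node n)
    (fun j => f (Polynomial.Chebyshev.node n j))

/-- `γ` is an integer. -/
def IsInteger (γ : ℝ) : Prop := ∃ m : ℤ, (m : ℝ) = γ

/-- The error at the point `x` of the polynomials `p n` approximating `f` is
`O(ln^μ n / n^s)` as `n → ∞` if `γ` is not an integer, and `O(ln^(μ-1) n / n^s)` if it is.
The implied constant may depend on `x`. -/
def ErrorRate (γ : ℝ) (μ : ℕ) (f : ℝ → ℝ) (p : ℕ → Polynomial ℝ) (x s : ℝ) : Prop :=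
  (¬ IsInteger γ →
    (fun n : ℕ => f x - (p n).eval x) =O[Filter.atTop]
      (fun n : ℕ => Real.log (n : ℝ) ^ μ / (n : ℝ) ^ s)) ∧
  (IsInteger γ →
    (fun n : ℕ => f x - (p n).eval x) =O[Filter.atTop]
      (fun n : ℕ => Real.log (n : ℝ) ^ (μ - 1) / (n : ℝ) ^ s))

end ChebInterp

/-! The interpolation error at `x` is a linear functional, and on a Cauchy kernel `1 / (t - y)` it
is explicit: `ω(x) / (ω(t) (t - x))`, where `ω` vanishes at the nodes. A singularity `(1 - y)^γ
log^j (1 - y)` is a combination of Stieltjes integrals of such kernels over `t = 1 + s`, `s > 0`. So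
its error is controlled by integrals of `s^γ |log s|^j |ω(x) / (ω(1 + s) (1 + s - x))|`. Take `ω =
T_{n+1}` for the first kind and `T_{n+1} - T_{n-1}` for the second. Since `T_N(cosh η) = cosh (N
η)`, the kernel decays faster than any fixed power of `n² s`; the integral lives on the scale `s ~
n⁻²`, and rescaling gives the power of `n` and the factor `log^j n`.

For integer `γ` the kernel must be regularised, and the density `log^j s` then produces `log^(j+1)
(1 - y)`: this is the logarithm saved (`integral_log_sub_inv`).

For general `g`, Taylor terms at `1` are peeled off one by one, each raising the exponent by one.
Once the remainder composed with `cos` is smooth enough, decay of its Chebyshev coefficients and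
aliasing bound its error (`isBigO_interpError_of_contDiff`). Reflection `y ↦ -y` handles the other
endpoint. -/

namespace ChebInterp

open Filter Topology MeasureTheory Set

/-! ### Interpolation error as a linear functional, and its value on Cauchy kernels -/

section

/-- The error at `x` of the polynomial interpolating `f` at the points `v 0, …, v n`. -/
noncomputable def interpError (v : ℕ → ℝ) (n : ℕ) (f : ℝ → ℝ) (x : ℝ) : ℝ :=
  f x - (Lagrange.interpolate (Finset.range (n + 1)) v (fun j => f (v j))).eval x

/-- The points on whose values the interpolation error at `x` depends. -/
def evalPoints (v : ℕ → ℝ) (n : ℕ) (x : ℝ) : Set ℝ :=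
  insert x (v '' (Finset.range (n + 1)))

variable {v : ℕ → ℝ} {n : ℕ} {x : ℝ}

lemma self_mem_evalPoints : x ∈ evalPoints v n x := mem_insert _ _

lemma node_mem_evalPoints {j : ℕ} (hj : j ∈ Finset.range (n + 1)) : v j ∈ evalPoints v n x :=
  mem_insert_of_mem _ (mem_image_of_mem _ (by exact_mod_cast hj))

lemma interpError_eq_sum (f : ℝ → ℝ) :
    interpError v n f x = f x - ∑ j ∈ Finset.range (n + 1),
      f (v j) * (Lagrange.basis (Finset.range (n + 1)) v j).eval x := by
  simp [interpError, Lagrange.interpolate_apply, Polynomial.eval_finsetSum]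

lemma interpError_congr {f g : ℝ → ℝ} (h : EqOn f g (evalPoints v n x)) :
    interpError v n f x = interpError v n g x := by
  rw [interpError_eq_sum, interpError_eq_sum, h self_mem_evalPoints]
  congr 1
  exact Finset.sum_congr rfl fun j hj => by rw [h (node_mem_evalPoints hj)]

lemma interpError_add (f g : ℝ → ℝ) :
    interpError v n (fun y => f y + g y) x = interpError v n f x + interpError v n g x := by
  simp only [interpError_eq_sum, add_mul, Finset.sum_add_distrib]; ring

lemma interpError_const_mul (c : ℝ) (f : ℝ → ℝ) :
    interpError v n (fun y => c * f y) x = c * interpError v n f x := by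
  simp only [interpError_eq_sum, mul_assoc, ← Finset.mul_sum]; ring

lemma interpError_sub (f g : ℝ → ℝ) :
    interpError v n (fun y => f y - g y) x = interpError v n f x - interpError v n g x := by
  simp only [interpError_eq_sum, sub_mul, Finset.sum_sub_distrib]; ring

lemma interpError_sum {ι : Type*} (s : Finset ι) (f : ι → ℝ → ℝ) :
    interpError v n (fun y => ∑ i ∈ s, f i y) x = ∑ i ∈ s, interpError v n (f i) x := by
  classical
  induction s using Finset.induction_on with
  | empty => simp [interpError_eq_sum]
  | insert a s ha ih => simp only [Finset.sum_insert ha, interpError_add, ih]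

lemma interpError_eq_sub_eval (hv : InjOn v (Finset.range (n + 1))) {f : ℝ → ℝ}
    {P : Polynomial ℝ} (hP : P.natDegree ≤ n) (h : ∀ j ∈ Finset.range (n + 1), P.eval (v j) = f (v j)) :
    interpError v n f x = f x - P.eval x := by
  rw [interpError, ← Lagrange.eq_interpolate_of_eval_eq _ hv (f := P) ?_ h]
  rw [Finset.card_range]
  exact lt_of_le_of_lt Polynomial.degree_le_natDegree (by exact_mod_cast Nat.lt_succ_of_le hP)

lemma interpError_polynomial (hv : InjOn v (Finset.range (n + 1))) {P : Polynomial ℝ}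
    (hP : P.natDegree ≤ n) : interpError v n (fun y => P.eval y) x = 0 := by
  rw [interpError_eq_sub_eval hv hP (fun _ _ => rfl), sub_self]

lemma interpError_node (hv : InjOn v (Finset.range (n + 1))) {j : ℕ} (hj : j ∈ Finset.range (n + 1))
    (f : ℝ → ℝ) : interpError v n f (v j) = 0 := by
  rw [interpError, Lagrange.eval_interpolate_at_node _ hv hj, sub_self]

lemma interpError_hasSum {ι : Type*} {F : ι → ℝ → ℝ} {f : ℝ → ℝ}
    (h : ∀ y ∈ evalPoints v n x, HasSum (fun i => F i y) (f y)) :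
    HasSum (fun i => interpError v n (F i) x) (interpError v n f x) := by
  simp only [interpError_eq_sum]
  exact (h x self_mem_evalPoints).sub
    (hasSum_sum fun j hj => (h _ (node_mem_evalPoints hj)).mul_right _)

/-- The functional is a finite combination of point evaluations, so integrability at those points is
enough; no uniformity in `y` is required. -/
lemma interpError_integral {α : Type*} [MeasurableSpace α] {ν : Measure α} {F : α → ℝ → ℝ}
    (h : ∀ y ∈ evalPoints v n x, Integrable (fun s => F s y) ν) :
    interpError v n (fun y => ∫ s, F s y ∂ν) x = ∫ s, interpError v n (F s) x ∂ν := by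
  simp only [interpError_eq_sum]
  rw [integral_sub (h x self_mem_evalPoints)
      (integrable_finsetSum _ fun j hj => (h _ (node_mem_evalPoints hj)).mul_const _),
    integral_finsetSum _ fun j hj => (h _ (node_mem_evalPoints hj)).mul_const _]
  simp only [integral_mul_const]

/-- The interpolation error of `(1 - y) ^ m / (t - y)`, in terms of a polynomial `ω` of degree at
most `n + 1` that vanishes at the interpolation points. -/
lemma interpError_kernel (hv : InjOn v (Finset.range (n + 1))) {ω : Polynomial ℝ}
    (hω : ω.natDegree ≤ n + 1) (hroot : ∀ j ∈ Finset.range (n + 1), ω.eval (v j) = 0)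
    {m : ℕ} (hm : m ≤ n + 1) {t : ℝ} (ht : ω.eval t ≠ 0) (hx : x ≠ t) :
    interpError v n (fun y => (1 - y) ^ m / (t - y)) x
      = (1 - t) ^ m * (ω.eval x / (ω.eval t * (t - x))) := by
  classical
  -- The multiple of `ω` is chosen so that `Q` vanishes at `t`. Then `Q / (t - y)` is a polynomial
  -- of degree at most `n`, and it agrees with the kernel at the nodes because `ω` vanishes there:
  -- it is the interpolant.
  set Q : Polynomial ℝ :=
    (1 - Polynomial.X) ^ m - Polynomial.C ((1 - t) ^ m / ω.eval t) * ω with hQ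
  have hQt : Q.IsRoot t := by
    simp only [hQ, Polynomial.IsRoot, Polynomial.eval_sub, Polynomial.eval_pow, Polynomial.eval_one,
      Polynomial.eval_X, Polynomial.eval_mul, Polynomial.eval_C]
    field_simp
    ring
  obtain ⟨P, hP⟩ := Polynomial.dvd_iff_isRoot.2 hQt
  have hdQ : Q.natDegree ≤ n + 1 := by
    refine (Polynomial.natDegree_sub_le _ _).trans (max_le ?_ ?_)
    · refine (Polynomial.natDegree_pow_le).trans ?_
      have : (1 - Polynomial.X : Polynomial ℝ).natDegree ≤ 1 :=
        (Polynomial.natDegree_sub_le _ _).trans (by simp)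
      nlinarith
    · exact (Polynomial.natDegree_C_mul_le _ _).trans hω
  have hdP : (-P).natDegree ≤ n := by
    rw [Polynomial.natDegree_neg]
    by_cases hP0 : P = 0
    · simp [hP0]
    have := Polynomial.natDegree_mul (Polynomial.X_sub_C_ne_zero t) hP0
    rw [← hP, Polynomial.natDegree_X_sub_C] at this
    omega
  have key : ∀ y, y ≠ t → (-P).eval y
      = (1 - y) ^ m / (t - y) - (1 - t) ^ m * (ω.eval y / (ω.eval t * (t - y))) := by
    intro y hy
    have h1 : Q.eval y = (y - t) * P.eval y := by rw [hP]; simp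
    have h2 : Q.eval y = (1 - y) ^ m - (1 - t) ^ m / ω.eval t * ω.eval y := by simp [hQ]
    have hty : t - y ≠ 0 := sub_ne_zero.2 hy.symm
    rw [Polynomial.eval_neg]
    have h3 : -P.eval y = Q.eval y / (t - y) := by rw [h1]; field_simp; ring
    rw [h3, h2]
    field_simp
  rw [interpError_eq_sub_eval hv hdP, key x hx]
  · ring
  · intro j hj
    have hne : v j ≠ t := fun h => ht (h ▸ hroot j hj)
    rw [key _ hne, hroot j hj]
    simp

end

/-! ### Logarithmic integrals on the half line and their scaling -/

section

lemma isBigO_log_pow_atTop (j : ℕ) {ε : ℝ} (hε : 0 < ε) :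
    (fun s : ℝ => Real.log s ^ j) =O[atTop] fun s => s ^ ε := by
  refine ((isLittleO_log_rpow_rpow_atTop (j : ℝ) hε).isBigO).congr_left fun s => ?_
  exact Real.rpow_natCast _ _

lemma isBigO_log_pow_zero (j : ℕ) {ε : ℝ} (hε : 0 < ε) :
    (fun s : ℝ => Real.log s ^ j) =O[𝓝[>] 0] fun s => s ^ (-ε) := by
  have h := (isLittleO_abs_log_rpow_rpow_nhdsGT_zero (j : ℝ) (neg_lt_zero.2 hε)).isBigO
  refine (Asymptotics.IsBigO.of_norm_left ?_)
  refine h.congr_left fun s => ?_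
  rw [Real.rpow_natCast, norm_pow, Real.norm_eq_abs]

lemma integrableOn_rpow_mul_log_pow {α κ C : ℝ} (hα : -1 < α) (hκ : α + 1 < κ) {h : ℝ → ℝ}
    (hc : ContinuousOn h (Ioi 0)) (h1 : ∀ s, 0 < s → |h s| ≤ C)
    (h2 : ∀ s, 0 < s → |h s| ≤ C * s ^ (-κ)) (j : ℕ) :
    IntegrableOn (fun s => s ^ α * (Real.log s ^ j * h s)) (Ioi 0) := by
  -- Convergence of a Mellin integral at `α + 1`. The exponents `a` and `b` are midpoints of `(α +
  -- 1, κ)` and `(0, α + 1)`; the halves left over absorb the powers of `log` at infinity and at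
  -- `0`.
  have key := mellin_convergent_of_isBigO_scalar (f := fun s => Real.log s ^ j * h s)
    (a := (α + 1 + κ) / 2) (b := (α + 1) / 2) (s := α + 1) ?_ ?_ (by linarith) ?_ (by linarith)
  · simpa using key
  · refine ContinuousOn.locallyIntegrableOn ?_ measurableSet_Ioi
    exact ((Real.continuousOn_log.mono fun s hs => ne_of_gt hs).pow j).mul hc
  · have hO : h =O[atTop] fun s : ℝ => s ^ (-κ) := by
      refine Asymptotics.IsBigO.of_bound C ?_
      filter_upwards [eventually_gt_atTop 0] with s hs
      rw [Real.norm_eq_abs, Real.norm_eq_abs, abs_of_pos (Real.rpow_pos_of_pos hs _)]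
      exact h2 s hs
    refine ((isBigO_log_pow_atTop j (ε := (κ - (α + 1)) / 2) (by linarith)).mul hO).congr'
      (Eventually.of_forall fun _ => rfl) ?_
    filter_upwards [eventually_gt_atTop 0] with s hs
    rw [← Real.rpow_add hs]
    congr 1; ring
  · have hO : h =O[𝓝[>] 0] fun _ : ℝ => (1 : ℝ) := by
      refine Asymptotics.IsBigO.of_bound C ?_
      filter_upwards [self_mem_nhdsWithin] with s hs
      simpa using h1 s hs
    simpa using (isBigO_log_pow_zero j (ε := (α + 1) / 2) (by linarith)).mul hO

lemma integrableOn_rpow_mul_abs_log_pow {α κ C : ℝ} (hα : -1 < α) (hκ : α + 1 < κ) {h : ℝ → ℝ}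
    (hc : ContinuousOn h (Ioi 0)) (h1 : ∀ s, 0 < s → |h s| ≤ C)
    (h2 : ∀ s, 0 < s → |h s| ≤ C * s ^ (-κ)) (j : ℕ) :
    IntegrableOn (fun s => s ^ α * ((1 + |Real.log s|) ^ j * h s)) (Ioi 0) := by
  have hi := ((integrableOn_rpow_mul_log_pow hα hκ hc h1 h2 0).norm.add
    (integrableOn_rpow_mul_log_pow hα hκ hc h1 h2 j).norm).const_mul (2 ^ (j - 1))
  refine Integrable.mono' hi ?_ ?_
  · refine ContinuousOn.aestronglyMeasurable ?_ measurableSet_Ioi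
    have hl : ContinuousOn Real.log (Ioi 0) := Real.continuousOn_log.mono fun s hs => ne_of_gt hs
    refine ContinuousOn.mul (ContinuousOn.rpow_const continuousOn_id fun s hs => Or.inl (ne_of_gt hs)) ?_
    exact ((continuousOn_const.add hl.abs).pow j).mul hc
  · refine (ae_restrict_iff' measurableSet_Ioi).2 (Eventually.of_forall fun s hs => ?_)
    have hp := add_pow_le (zero_le_one (α := ℝ)) (abs_nonneg (Real.log s)) j
    simp only [Pi.add_apply, norm_mul, Real.norm_eq_abs, abs_pow, pow_zero, one_mul] at hp ⊢
    rw [abs_of_nonneg (show (0 : ℝ) ≤ 1 + |Real.log s| by positivity)]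
    rw [one_pow] at hp
    calc |s ^ α| * ((1 + |Real.log s|) ^ j * |h s|)
        ≤ |s ^ α| * ((2 ^ (j - 1) * (1 + |Real.log s| ^ j)) * |h s|) := by gcongr
      _ = _ := by ring

/-- The weight `(1 + c s) ^ (-K)` satisfies the bounds of `integrableOn_rpow_mul_log_pow`. -/
lemma abs_inv_pow_le {c s : ℝ} (hc : 0 < c) (hs : 0 < s) (K : ℕ) :
    |((1 + c * s) ^ K)⁻¹| ≤ max 1 (c⁻¹ ^ K) ∧
      |((1 + c * s) ^ K)⁻¹| ≤ max 1 (c⁻¹ ^ K) * s ^ (-(K : ℝ)) := by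
  have hcs : 0 < c * s := mul_pos hc hs
  have h0 : (0 : ℝ) < (1 + c * s) ^ K := by positivity
  rw [abs_of_pos (inv_pos.2 h0)]
  constructor
  · exact (inv_le_one_of_one_le₀ (one_le_pow₀ (by linarith))).trans (le_max_left _ _)
  · rw [Real.rpow_neg hs.le, Real.rpow_natCast]
    calc ((1 + c * s) ^ K)⁻¹ ≤ ((c * s) ^ K)⁻¹ := by gcongr; linarith
      _ = c⁻¹ ^ K * (s ^ K)⁻¹ := by rw [mul_pow, mul_inv, inv_pow]
      _ ≤ _ := by gcongr; exact le_max_right _ _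

/-- A scaling estimate for weighted logarithmic integrals concentrated on the scale `n⁻²`. -/
lemma exists_integral_rpow_log_le {α c : ℝ} (hα : -1 < α) (hc : 0 < c) (j K : ℕ)
    (hK : α + 1 < K) :
    ∃ C, 0 ≤ C ∧ ∀ n : ℕ, 3 ≤ n →
      IntegrableOn (fun s => s ^ α * (|Real.log s| ^ j * ((1 + c * ((n : ℝ) ^ 2 * s)) ^ K)⁻¹))
        (Ioi 0) ∧
      ∫ s in Ioi 0, s ^ α * (|Real.log s| ^ j * ((1 + c * ((n : ℝ) ^ 2 * s)) ^ K)⁻¹)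
        ≤ C * (Real.log n ^ j / (n : ℝ) ^ (2 * α + 2)) := by
  set G : ℝ → ℝ := fun s => s ^ α * ((1 + |Real.log s|) ^ j * ((1 + c * s) ^ K)⁻¹) with hG
  have hGi : IntegrableOn G (Ioi 0) := by
    refine integrableOn_rpow_mul_abs_log_pow hα hK ?_ (fun s hs => (abs_inv_pow_le hc hs K).1)
      (fun s hs => (abs_inv_pow_le hc hs K).2) j
    refine ContinuousOn.inv₀ (by fun_prop) fun s hs => ?_
    have : 0 < c * s := mul_pos hc hs
    positivity
  have hG0 : ∀ s ∈ Ioi (0 : ℝ), 0 ≤ G s := fun s hs => by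
    have : 0 < c * s := mul_pos hc hs
    have : 0 < s := hs
    simp only [hG]; positivity
  refine ⟨2 ^ j * ∫ s in Ioi 0, G s,
    mul_nonneg (by positivity) (setIntegral_nonneg measurableSet_Ioi hG0), fun n hn => ?_⟩
  have hn0 : (0 : ℝ) < n := by exact_mod_cast (by omega : 0 < n)
  have hn2 : (0 : ℝ) < (n : ℝ) ^ 2 := by positivity
  have hlog : 1 ≤ Real.log n := by
    rw [Real.le_log_iff_exp_le hn0]
    exact Real.exp_one_lt_three.le.trans (by exact_mod_cast hn)
  have hcomp : IntegrableOn (fun s => G ((n : ℝ) ^ 2 * s)) (Ioi 0) :=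
    (integrableOn_Ioi_comp_mul_left_iff G 0 hn2).2 (by simpa using hGi)
  have hb : ∀ s ∈ Ioi (0 : ℝ),
      s ^ α * (|Real.log s| ^ j * ((1 + c * ((n : ℝ) ^ 2 * s)) ^ K)⁻¹)
        ≤ ((n : ℝ) ^ (-(2 * α)) * (2 * Real.log n) ^ j) * G ((n : ℝ) ^ 2 * s) := by
    intro s hs
    have hs0 : 0 < s := hs
    have h1 : ((n : ℝ) ^ 2 * s) ^ α = (n : ℝ) ^ (2 * α) * s ^ α := by
      rw [Real.mul_rpow hn2.le hs0.le, ← Real.rpow_natCast, ← Real.rpow_mul hn0.le]; norm_num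
    -- The sum `2 log n + |log (n² s)|` is bounded by a product, which uses `1 ≤ log n`; hence the
    -- restriction `3 ≤ n`.
    have h2 : |Real.log s| ≤ 2 * Real.log n * (1 + |Real.log ((n : ℝ) ^ 2 * s)|) := by
      have : Real.log s = Real.log ((n : ℝ) ^ 2 * s) - 2 * Real.log n := by
        rw [Real.log_mul hn2.ne' hs0.ne', Real.log_pow]; push_cast; ring
      have h3 := abs_sub (Real.log ((n : ℝ) ^ 2 * s)) (2 * Real.log n)
      rw [← this, abs_of_nonneg (by linarith : (0 : ℝ) ≤ 2 * Real.log n)] at h3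
      nlinarith [abs_nonneg (Real.log ((n : ℝ) ^ 2 * s))]
    have h4 : (n : ℝ) ^ (-(2 * α)) * (n : ℝ) ^ (2 * α) = 1 := by
      rw [← Real.rpow_add hn0]; simp
    calc s ^ α * (|Real.log s| ^ j * ((1 + c * ((n : ℝ) ^ 2 * s)) ^ K)⁻¹)
        ≤ s ^ α * ((2 * Real.log n * (1 + |Real.log ((n : ℝ) ^ 2 * s)|)) ^ j
            * ((1 + c * ((n : ℝ) ^ 2 * s)) ^ K)⁻¹) := by gcongr
      _ = ((n : ℝ) ^ (-(2 * α)) * (n : ℝ) ^ (2 * α)) * (s ^ α *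
            ((2 * Real.log n * (1 + |Real.log ((n : ℝ) ^ 2 * s)|)) ^ j
            * ((1 + c * ((n : ℝ) ^ 2 * s)) ^ K)⁻¹)) := by rw [h4, one_mul]
      _ = _ := by simp only [hG, h1, mul_pow]; ring
  have hI := hcomp.const_mul ((n : ℝ) ^ (-(2 * α)) * (2 * Real.log n) ^ j)
  have hi : IntegrableOn
      (fun s => s ^ α * (|Real.log s| ^ j * ((1 + c * ((n : ℝ) ^ 2 * s)) ^ K)⁻¹)) (Ioi 0) := by
    refine Integrable.mono' hI ?_ ?_
    · refine ContinuousOn.aestronglyMeasurable ?_ measurableSet_Ioi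
      have hl : ContinuousOn Real.log (Ioi 0) := Real.continuousOn_log.mono fun s hs => ne_of_gt hs
      refine ContinuousOn.mul
        (ContinuousOn.rpow_const continuousOn_id fun s hs => Or.inl (ne_of_gt hs)) ?_
      refine (hl.abs.pow j).mul (ContinuousOn.inv₀ (by fun_prop) fun s hs => ?_)
      have : 0 < c * ((n : ℝ) ^ 2 * s) := mul_pos hc (mul_pos hn2 hs)
      positivity
    · refine (ae_restrict_iff' measurableSet_Ioi).2 (Eventually.of_forall fun s hs => ?_)
      have : 0 < c * ((n : ℝ) ^ 2 * s) := mul_pos hc (mul_pos hn2 hs)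
      have hs0 : 0 < s := hs
      rw [Real.norm_of_nonneg (by positivity)]
      exact hb s hs
  refine ⟨hi, (setIntegral_mono_on hi hI measurableSet_Ioi hb).trans (le_of_eq ?_)⟩
  rw [integral_const_mul, integral_comp_mul_left_Ioi G 0 hn2, mul_zero, smul_eq_mul, mul_pow,
    show (n : ℝ) ^ (-(2 * α)) = (n : ℝ) ^ 2 * ((n : ℝ) ^ (2 * α + 2))⁻¹ by
      rw [← Real.rpow_neg hn0.le, ← Real.rpow_natCast, ← Real.rpow_add hn0]; congr 1; push_cast; ring]
  field_simp

end

/-! ### Stieltjes transforms of powers times logarithms -/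

section

/-- The logarithmic moments of a weight `h` on the half line. -/
noncomputable def logMoment (β : ℝ) (h : ℝ → ℝ) (k : ℕ) : ℝ :=
  ∫ s in Ioi (0 : ℝ), s ^ β * (Real.log s ^ k * h s)

/-- Substituting `s = u v` turns `log s` into `log u + log v`; the binomial theorem does the rest.
-/
lemma integral_rpow_log_scaled {β u : ℝ} (hu : 0 < u) {h : ℝ → ℝ}
    (hi : ∀ k : ℕ, IntegrableOn (fun s => s ^ β * (Real.log s ^ k * h s)) (Ioi 0)) (j : ℕ) :
    ∫ s in Ioi (0 : ℝ), s ^ β * (Real.log s ^ j * h (s / u))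
      = u ^ (β + 1) * ∑ i ∈ Finset.range (j + 1),
          Real.log u ^ i * (j.choose i) * logMoment β h (j - i) := by
  have hcv := integral_comp_mul_left_Ioi
    (fun s => s ^ β * (Real.log s ^ j * h (s / u))) 0 hu
  rw [mul_zero, smul_eq_mul] at hcv
  have h1 : ∫ s in Ioi (0 : ℝ), s ^ β * (Real.log s ^ j * h (s / u))
      = u * ∫ v in Ioi (0 : ℝ), (u * v) ^ β * (Real.log (u * v) ^ j * h (u * v / u)) := by
    rw [hcv]; field_simp
  have h2 : ∫ v in Ioi (0 : ℝ), (u * v) ^ β * (Real.log (u * v) ^ j * h (u * v / u))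
      = ∫ v in Ioi (0 : ℝ), ∑ i ∈ Finset.range (j + 1),
        (u ^ β * (Real.log u ^ i * (j.choose i))) *
          (v ^ β * (Real.log v ^ (j - i) * h v)) := by
    refine setIntegral_congr_fun measurableSet_Ioi fun v hv => ?_
    have hv0 : (0 : ℝ) < v := hv
    rw [Real.mul_rpow hu.le hv0.le, Real.log_mul hu.ne' hv0.ne', add_pow,
      mul_div_cancel_left₀ v hu.ne', Finset.sum_mul, Finset.mul_sum]
    exact Finset.sum_congr rfl fun i _ => by ring
  rw [h1, h2, integral_finsetSum _ fun i _ => (hi (j - i)).const_mul _, Real.rpow_add hu,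
    Real.rpow_one, Finset.mul_sum, Finset.mul_sum]
  refine Finset.sum_congr rfl fun i _ => ?_
  rw [integral_const_mul, logMoment]
  ring

lemma integrableOn_rpow_log_inv {β u : ℝ} (hβ : -1 < β) (hβ0 : β < 0) (hu : 0 < u) (j : ℕ) :
    IntegrableOn (fun s => s ^ β * (Real.log s ^ j * (s + u)⁻¹)) (Ioi 0) := by
  refine integrableOn_rpow_mul_log_pow (κ := 1) (C := max 1 u⁻¹) hβ (by linarith) ?_ ?_ ?_ j
  · exact ContinuousOn.inv₀ (by fun_prop) fun s hs => (add_pos hs hu).ne'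
  · intro s hs
    rw [abs_of_pos (by positivity)]
    exact (inv_anti₀ hu (by linarith)).trans (le_max_right _ _)
  · intro s hs
    rw [abs_of_pos (by positivity), Real.rpow_neg_one]
    calc (s + u)⁻¹ ≤ s⁻¹ := inv_anti₀ hs (by linarith)
      _ ≤ _ := le_mul_of_one_le_left (by positivity) (le_max_left _ _)

lemma integrableOn_log_inv_sq {u : ℝ} (hu : 0 < u) (j : ℕ) :
    IntegrableOn (fun s => s ^ (0 : ℝ) * (Real.log s ^ j * ((s + u) ^ 2)⁻¹)) (Ioi 0) := by
  refine integrableOn_rpow_mul_log_pow (κ := 2) (C := max 1 (u ^ 2)⁻¹) (by norm_num) (by norm_num)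
    ?_ ?_ ?_ j
  · exact ContinuousOn.inv₀ (by fun_prop) fun s hs => by
      have : 0 < s + u := add_pos hs hu
      positivity
  · intro s hs
    rw [abs_of_pos (by positivity)]
    exact (inv_anti₀ (by positivity) (by gcongr; linarith)).trans (le_max_right _ _)
  · intro s hs
    rw [abs_of_pos (by positivity), Real.rpow_neg hs.le, Real.rpow_two]
    calc ((s + u) ^ 2)⁻¹ ≤ (s ^ 2)⁻¹ := inv_anti₀ (by positivity) (by gcongr; linarith)
      _ ≤ _ := le_mul_of_one_le_left (by positivity) (le_max_left _ _)

/-- This moment is the top coefficient `i = j` in `integral_rpow_log_inv`; its positivity allows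
that relation to be solved for `u ^ β * log u ^ j`. -/
lemma logMoment_inv_pos {β : ℝ} (hβ : -1 < β) (hβ0 : β < 0) :
    0 < logMoment β (fun s => (s + 1)⁻¹) 0 := by
  have hi := integrableOn_rpow_log_inv hβ hβ0 one_pos 0
  rw [logMoment, setIntegral_pos_iff_support_of_nonneg_ae _ hi]
  · have : Ioi (0 : ℝ) ⊆
        Function.support (fun s : ℝ => s ^ β * (Real.log s ^ 0 * (s + 1)⁻¹)) := by
      intro s hs
      have hs0 : (0 : ℝ) < s := hs
      simp only [Function.mem_support]
      positivity
    rw [inter_eq_right.2 this]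
    simp
  · refine (ae_restrict_iff' measurableSet_Ioi).2 (Eventually.of_forall fun s hs => ?_)
    have hs0 : (0 : ℝ) < s := hs
    simp only [Pi.zero_apply]
    positivity

/-- Stieltjes transforms of `s ^ β * log s ^ j` for `-1 < β < 0`. -/
lemma integral_rpow_log_inv {β u : ℝ} (hβ : -1 < β) (hβ0 : β < 0) (hu : 0 < u) (j : ℕ) :
    ∫ s in Ioi (0 : ℝ), s ^ β * (Real.log s ^ j * (s + u)⁻¹)
      = ∑ i ∈ Finset.range (j + 1),
          ((j.choose i) * logMoment β (fun s => (s + 1)⁻¹) (j - i)) *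
            (u ^ β * Real.log u ^ i) := by
  have h := integral_rpow_log_scaled hu (fun k => integrableOn_rpow_log_inv hβ hβ0 one_pos k) j
  have h' : ∫ s in Ioi (0 : ℝ), s ^ β * (Real.log s ^ j * (s + u)⁻¹)
      = u⁻¹ * ∫ s in Ioi (0 : ℝ), s ^ β * (Real.log s ^ j * (s / u + 1)⁻¹) := by
    rw [← integral_const_mul]
    refine setIntegral_congr_fun measurableSet_Ioi fun s hs => ?_
    have : (s + u)⁻¹ = u⁻¹ * (s / u + 1)⁻¹ := by
      rw [← mul_inv, mul_add, mul_one, mul_div_cancel₀ _ hu.ne']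
    simp only [this]; ring
  rw [h', h, Real.rpow_add hu, Real.rpow_one, Finset.mul_sum, Finset.mul_sum]
  refine Finset.sum_congr rfl fun i _ => ?_
  field_simp

lemma integral_log_inv_sq {u : ℝ} (hu : 0 < u) (j : ℕ) :
    ∫ s in Ioi (0 : ℝ), s ^ (0 : ℝ) * (Real.log s ^ j * ((s + u) ^ 2)⁻¹)
      = ∑ i ∈ Finset.range (j + 1),
          ((j.choose i) * logMoment 0 (fun s => ((s + 1) ^ 2)⁻¹) (j - i)) *
            (Real.log u ^ i * u⁻¹) := by
  have h := integral_rpow_log_scaled hu (fun k => integrableOn_log_inv_sq one_pos k) j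
  have h' : ∫ s in Ioi (0 : ℝ), s ^ (0 : ℝ) * (Real.log s ^ j * ((s + u) ^ 2)⁻¹)
      = (u ^ 2)⁻¹ * ∫ s in Ioi (0 : ℝ), s ^ (0 : ℝ) * (Real.log s ^ j * ((s / u + 1) ^ 2)⁻¹) := by
    rw [← integral_const_mul]
    refine setIntegral_congr_fun measurableSet_Ioi fun s hs => ?_
    have : ((s + u) ^ 2)⁻¹ = (u ^ 2)⁻¹ * ((s / u + 1) ^ 2)⁻¹ := by
      rw [← mul_inv, ← mul_pow, mul_add, mul_one, mul_div_cancel₀ _ hu.ne']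
    simp only [this]; ring
  rw [h', h, zero_add, Real.rpow_one, Finset.mul_sum, Finset.mul_sum]
  refine Finset.sum_congr rfl fun i _ => ?_
  field_simp

lemma logMoment_inv_sq_pos : 0 < logMoment 0 (fun s => ((s + 1) ^ 2)⁻¹) 0 := by
  have hi := integrableOn_log_inv_sq one_pos 0
  rw [logMoment, setIntegral_pos_iff_support_of_nonneg_ae _ hi]
  · have : Ioi (0 : ℝ) ⊆
        Function.support (fun s : ℝ => s ^ (0 : ℝ) * (Real.log s ^ 0 * ((s + 1) ^ 2)⁻¹)) := by
      intro s hs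
      have hs0 : (0 : ℝ) < s := hs
      simp only [Function.mem_support]
      positivity
    rw [inter_eq_right.2 this]
    simp
  · refine (ae_restrict_iff' measurableSet_Ioi).2 (Eventually.of_forall fun s hs => ?_)
    have hs0 : (0 : ℝ) < s := hs
    simp only [Pi.zero_apply]
    positivity

/-- At exponent `0` the kernel `(s + u)⁻¹` alone is not integrable at infinity. Subtracting its
value at `u = 1` leaves quadratic decay. -/
lemma integrableOn_log_sub_inv {u : ℝ} (hu : 0 < u) (j : ℕ) :
    IntegrableOn (fun s => s ^ (0 : ℝ) * (Real.log s ^ j * ((s + 1)⁻¹ - (s + u)⁻¹))) (Ioi 0) := by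
  have heq : ∀ s : ℝ, 0 < s → (s + 1)⁻¹ - (s + u)⁻¹ = (u - 1) * ((s + 1)⁻¹ * (s + u)⁻¹) := by
    intro s hs
    have : 0 < s + u := by linarith
    field_simp; ring
  refine integrableOn_rpow_mul_log_pow (κ := 2) (C := |u - 1| * max 1 u⁻¹) (by norm_num)
    (by norm_num) ?_ ?_ ?_ j
  · refine ContinuousOn.sub ?_ ?_
    · exact ContinuousOn.inv₀ (by fun_prop) fun s hs => (add_pos hs one_pos).ne'
    · exact ContinuousOn.inv₀ (by fun_prop) fun s hs => (add_pos hs hu).ne'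
  · intro s hs
    rw [heq s hs, abs_mul, abs_of_pos (show 0 < (s + 1)⁻¹ * (s + u)⁻¹ by positivity)]
    gcongr
    calc (s + 1)⁻¹ * (s + u)⁻¹ ≤ 1 * u⁻¹ := by
          gcongr
          · exact inv_le_one_of_one_le₀ (by linarith)
          · linarith
      _ ≤ _ := by rw [one_mul]; exact le_max_right _ _
  · intro s hs
    rw [heq s hs, abs_mul, abs_of_pos (show 0 < (s + 1)⁻¹ * (s + u)⁻¹ by positivity),
      mul_assoc |u - 1| (max 1 u⁻¹)]
    refine mul_le_mul_of_nonneg_left ?_ (abs_nonneg _)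
    rw [Real.rpow_neg hs.le, Real.rpow_two]
    calc (s + 1)⁻¹ * (s + u)⁻¹ ≤ s⁻¹ * s⁻¹ := by gcongr <;> linarith
      _ = (s ^ 2)⁻¹ := by rw [sq, mul_inv]
      _ ≤ _ := le_mul_of_one_le_left (by positivity) (le_max_left _ _)

lemma hasDerivAt_integral_log_sub_inv {u : ℝ} (hu : 0 < u) (j : ℕ) :
    HasDerivAt (fun w => ∫ s in Ioi (0 : ℝ),
        s ^ (0 : ℝ) * (Real.log s ^ j * ((s + 1)⁻¹ - (s + w)⁻¹)))
      (∫ s in Ioi (0 : ℝ), s ^ (0 : ℝ) * (Real.log s ^ j * ((s + u) ^ 2)⁻¹)) u := by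
  refine (hasDerivAt_integral_of_dominated_loc_of_deriv_le
    (μ := volume.restrict (Ioi (0 : ℝ)))
    (F := fun w s => s ^ (0 : ℝ) * (Real.log s ^ j * ((s + 1)⁻¹ - (s + w)⁻¹)))
    (F' := fun w s => s ^ (0 : ℝ) * (Real.log s ^ j * ((s + w) ^ 2)⁻¹))
    (bound := fun s => ‖s ^ (0 : ℝ) * (Real.log s ^ j * ((s + u / 2) ^ 2)⁻¹)‖)
    (s := Ioi (u / 2)) (Ioi_mem_nhds (by linarith)) ?_ (integrableOn_log_sub_inv hu j)
    (integrableOn_log_inv_sq hu j).aestronglyMeasurable ?_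
    (integrableOn_log_inv_sq (half_pos hu) j).norm ?_).2
  · filter_upwards [Ioi_mem_nhds hu] with w hw
    exact (integrableOn_log_sub_inv hw j).aestronglyMeasurable
  · refine (ae_restrict_iff' measurableSet_Ioi).2 (Eventually.of_forall fun s hs w hw => ?_)
    have hs0 : (0 : ℝ) < s := hs
    have hw0 : u / 2 < w := hw
    have hw1 : 0 < w := by linarith
    simp only [norm_mul, norm_inv, norm_pow, Real.norm_eq_abs]
    rw [abs_of_pos (show 0 < s + w by linarith), abs_of_pos (show 0 < s + u / 2 by linarith)]
    gcongr
  · refine (ae_restrict_iff' measurableSet_Ioi).2 (Eventually.of_forall fun s hs w hw => ?_)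
    have hs0 : (0 : ℝ) < s := hs
    have hw0 : u / 2 < w := hw
    have hsw : s + w ≠ 0 := by linarith
    have h := ((hasDerivAt_id w).const_add s).inv hsw
    have h2 := ((h.const_sub ((s + 1)⁻¹)).const_mul (Real.log s ^ j)).const_mul (s ^ (0 : ℝ))
    refine h2.congr_deriv ?_
    simp [neg_div]

/-- Regularised Stieltjes transforms of `log s ^ j`. -/
lemma integral_log_sub_inv {u : ℝ} (hu : 0 < u) (j : ℕ) :
    ∫ s in Ioi (0 : ℝ), s ^ (0 : ℝ) * (Real.log s ^ j * ((s + 1)⁻¹ - (s + u)⁻¹))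
      = ∑ i ∈ Finset.range (j + 1),
          ((j.choose i) * logMoment 0 (fun s => ((s + 1) ^ 2)⁻¹) (j - i) / (i + 1)) *
            Real.log u ^ (i + 1) := by
  -- `D` is the difference of the two sides. Its derivative vanishes by `integral_log_inv_sq`, and
  -- `D 1 = 0`. Integrating `log u ^ i / u` raises the degree in `log u` by one.
  set D : ℝ → ℝ := fun w => (∫ s in Ioi (0 : ℝ),
      s ^ (0 : ℝ) * (Real.log s ^ j * ((s + 1)⁻¹ - (s + w)⁻¹)))
    - ∑ i ∈ Finset.range (j + 1),
        ((j.choose i) * logMoment 0 (fun s => ((s + 1) ^ 2)⁻¹) (j - i) / (i + 1)) *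
          Real.log w ^ (i + 1) with hD
  have hder : ∀ w ∈ Ioi (0 : ℝ), HasDerivAt D 0 w := by
    intro w hw
    have hw0 : (0 : ℝ) < w := hw
    have hsum : HasDerivAt (fun w => ∑ i ∈ Finset.range (j + 1),
        ((j.choose i) * logMoment 0 (fun s => ((s + 1) ^ 2)⁻¹) (j - i) / (i + 1)) *
          Real.log w ^ (i + 1))
        (∑ i ∈ Finset.range (j + 1),
          ((j.choose i) * logMoment 0 (fun s => ((s + 1) ^ 2)⁻¹) (j - i)) *
            (Real.log w ^ i * w⁻¹)) w := by
      refine HasDerivAt.fun_sum fun i _ => ?_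
      refine (((Real.hasDerivAt_log hw0.ne').pow (i + 1)).const_mul _).congr_deriv ?_
      have : (i : ℝ) + 1 ≠ 0 := by positivity
      push_cast
      field_simp
    refine ((hasDerivAt_integral_log_sub_inv hw0 j).sub hsum).congr_deriv ?_
    rw [integral_log_inv_sq hw0 j, sub_self]
  have hconst := IsOpen.is_const_of_deriv_eq_zero isOpen_Ioi isPreconnected_Ioi
    (fun w hw => (hder w hw).differentiableAt.differentiableWithinAt)
    (fun w hw => (hder w hw).deriv) (show u ∈ Ioi (0 : ℝ) from hu) (show (1 : ℝ) ∈ Ioi 0 from mem_Ioi.2 one_pos)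
  have h1 : D 1 = 0 := by simp [hD]
  exact sub_eq_zero.1 (hconst.trans h1)

end

/-! ### Error rates of the model singularities -/

section

/-- Families of interpolation points `v n`, with polynomials `ω n` vanishing at them, for which the
kernel `ω n (x) / (ω n (t) * (t - x))` decays rapidly in `n ^ 2 * (t - 1)` for `t > 1`. -/
structure KernelBound (v : ℕ → ℕ → ℝ) (ω : ℕ → Polynomial ℝ) (x a b : ℝ) : Prop where
  injOn : ∀ᶠ n in atTop, InjOn (v n) (Finset.range (n + 1))
  natDegree_le : ∀ n, (ω n).natDegree ≤ n + 1
  root : ∀ᶠ n in atTop, ∀ j ∈ Finset.range (n + 1), (ω n).eval (v n j) = 0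
  mem : ∀ᶠ n in atTop, evalPoints (v n) n x ⊆ Icc (-1) 1
  bound : ∀ K : ℕ, ∃ C, 0 ≤ C ∧ ∃ c, 0 < c ∧ ∀ᶠ n : ℕ in atTop, ∀ s, 0 < s →
    (ω n).eval (1 + s) ≠ 0 ∧
    |(ω n).eval x / ((ω n).eval (1 + s) * (1 + s - x))|
      ≤ C * (n : ℝ) ^ (-b) * (s ^ (-a) * ((1 + c * ((n : ℝ) ^ 2 * s)) ^ K)⁻¹)

variable {v : ℕ → ℕ → ℝ} {ω : ℕ → Polynomial ℝ} {x a b : ℝ}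

lemma isBigO_log_pow_div_rpow {i j : ℕ} (hij : i ≤ j) {σ τ : ℝ} (h : τ ≤ σ) :
    (fun n : ℕ => Real.log (n : ℝ) ^ i / (n : ℝ) ^ σ) =O[atTop]
      fun n : ℕ => Real.log (n : ℝ) ^ j / (n : ℝ) ^ τ := by
  refine Asymptotics.IsBigO.of_bound 1 ?_
  filter_upwards [eventually_ge_atTop 3] with n hn
  have hn0 : (0 : ℝ) < n := by exact_mod_cast (by omega : 0 < n)
  have hn1 : (1 : ℝ) ≤ n := by exact_mod_cast (by omega : 1 ≤ n)
  have hlog : 1 ≤ Real.log n := by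
    rw [Real.le_log_iff_exp_le hn0]
    exact Real.exp_one_lt_three.le.trans (by exact_mod_cast hn)
  have h0 : 0 < Real.log n := by linarith
  rw [one_mul, Real.norm_of_nonneg (by positivity), Real.norm_of_nonneg (by positivity)]
  gcongr

/-- The exponent `a` of the kernel bound weakens the weight at `s = 0` to `s ^ (γ - a)`, and `b` is
an extra power of `n`. Any `K > γ - a + 1` makes the rescaled integral converge. -/
lemma isBigO_interpError_integral (H : KernelBound v ω x a b) {γ σ : ℝ} (hγ : -1 < γ - a)
    (hσ : σ ≤ 2 * (γ - a) + 2 + b) (j : ℕ) {F : ℝ → ℝ → ℝ}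
    (hint : ∀ᶠ n in atTop, ∀ y ∈ evalPoints (v n) n x, IntegrableOn (fun s => F s y) (Ioi 0))
    (hF : ∀ᶠ n in atTop, ∀ s, 0 < s → |interpError (v n) n (F s) x| =
      s ^ γ * (|Real.log s| ^ j * |(ω n).eval x / ((ω n).eval (1 + s) * (1 + s - x))|)) :
    (fun n => interpError (v n) n (fun y => ∫ s in Ioi 0, F s y) x) =O[atTop]
      fun n : ℕ => Real.log (n : ℝ) ^ j / (n : ℝ) ^ σ := by
  obtain ⟨K, hK⟩ := exists_nat_gt (γ - a + 1)
  obtain ⟨C, hC, c, hc, hb⟩ := H.bound K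
  obtain ⟨D, hD, hDn⟩ := exists_integral_rpow_log_le hγ hc j K hK
  refine Asymptotics.IsBigO.trans ?_ (isBigO_log_pow_div_rpow le_rfl hσ)
  refine Asymptotics.IsBigO.of_bound (C * D) ?_
  filter_upwards [hint, hF, hb, eventually_ge_atTop 3] with n hi hFn hbn hn
  have hn0 : (0 : ℝ) < n := by exact_mod_cast (by omega : 0 < n)
  have hn1 : (1 : ℝ) ≤ n := by exact_mod_cast (by omega : 1 ≤ n)
  have hlog : 0 ≤ Real.log n := Real.log_nonneg hn1
  obtain ⟨hI, hle⟩ := hDn n hn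
  rw [interpError_integral hi]
  have h1 : ‖∫ s in Ioi 0, interpError (v n) n (F s) x‖ ≤ ∫ s in Ioi 0, C * (n : ℝ) ^ (-b) *
      (s ^ (γ - a) * (|Real.log s| ^ j * ((1 + c * ((n : ℝ) ^ 2 * s)) ^ K)⁻¹)) := by
    refine norm_integral_le_of_norm_le (hI.const_mul _)
      ((ae_restrict_iff' measurableSet_Ioi).2 (Eventually.of_forall fun s hs => ?_))
    have hs0 : (0 : ℝ) < s := hs
    rw [Real.norm_eq_abs, hFn s hs0]
    calc s ^ γ * (|Real.log s| ^ j * |(ω n).eval x / ((ω n).eval (1 + s) * (1 + s - x))|)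
        ≤ s ^ γ * (|Real.log s| ^ j *
          (C * (n : ℝ) ^ (-b) * (s ^ (-a) * ((1 + c * ((n : ℝ) ^ 2 * s)) ^ K)⁻¹))) := by
          gcongr
          exact (hbn s hs0).2
      _ = _ := by rw [sub_eq_add_neg, Real.rpow_add hs0]; ring
  refine h1.trans ?_
  rw [integral_const_mul, Real.norm_of_nonneg (by positivity)]
  calc C * (n : ℝ) ^ (-b) * _ ≤ C * (n : ℝ) ^ (-b) *
        (D * (Real.log n ^ j / (n : ℝ) ^ (2 * (γ - a) + 2))) := by gcongr
    _ = C * D * (Real.log n ^ j / (n : ℝ) ^ (2 * (γ - a) + 2 + b)) := by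
      rw [Real.rpow_add hn0 _ b, Real.rpow_neg hn0.le]; field_simp

/-- Forward substitution in a lower triangular system with nonzero diagonal. -/
lemma isBigO_of_triangular {S e : ℕ → ℕ → ℝ} {c : ℕ → ℕ → ℝ} {L : ℕ → ℕ → ℝ}
    (hS : ∀ j, ∀ᶠ n in atTop, S j n = ∑ i ∈ Finset.range (j + 1), c j i * e i n)
    (hc : ∀ j, c j j ≠ 0) (hO : ∀ j, S j =O[atTop] L j)
    (hL : ∀ i j, i ≤ j → L i =O[atTop] L j) (j : ℕ) : e j =O[atTop] L j := by
  induction j using Nat.strong_induction_on with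
  | _ j ih =>
    have h1 : (fun n => (c j j)⁻¹ * (S j n - ∑ i ∈ Finset.range j, c j i * e i n)) =O[atTop] L j := by
      refine Asymptotics.IsBigO.const_mul_left ((hO j).sub ?_) _
      refine Asymptotics.IsBigO.fun_sum fun i hi => ?_
      have hij := Finset.mem_range.1 hi
      exact ((ih i hij).trans (hL i j hij.le)).const_mul_left _
    refine h1.congr' ?_ EventuallyEq.rfl
    filter_upwards [hS j] with n hn
    rw [hn, Finset.sum_range_succ, add_sub_cancel_left, inv_mul_cancel_left₀ (hc j)]

/-- The model singularity `(1 - x) ^ γ * log (1 - x) ^ i`. -/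
noncomputable def singPow (γ : ℝ) (i : ℕ) (y : ℝ) : ℝ := (1 - y) ^ γ * Real.log (1 - y) ^ i

lemma singPow_one {γ : ℝ} (hγ : 0 < γ) (i : ℕ) : singPow γ i 1 = 0 := by
  simp [singPow, Real.zero_rpow hγ.ne']

/-- With `γ = β + m` and `-1 < β < 0`, the Stieltjes transform represents `(1 - y) ^ β`, and the
factor `(1 - y) ^ m` goes into the kernel. The error formula turns that factor into `(-s) ^ m`,
which restores the weight `s ^ γ` up to sign. -/
lemma isBigO_interpError_singPow_of_not_integer (H : KernelBound v ω x a b) (hx : x ≤ 1) {γ σ : ℝ}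
    (hγ1 : -1 < γ) (hγ : -1 < γ - a) (hint : ¬ IsInteger γ) (hσ : σ ≤ 2 * (γ - a) + 2 + b)
    (hpt : ∀ᶠ n in atTop, ∀ y ∈ evalPoints (v n) n x, y = 1 → 0 < γ) (j : ℕ) :
    (fun n => interpError (v n) n (singPow γ j) x) =O[atTop]
      fun n : ℕ => Real.log (n : ℝ) ^ j / (n : ℝ) ^ σ := by
  obtain ⟨m, β, hβ, hβ0, hγm⟩ : ∃ m : ℕ, ∃ β : ℝ, -1 < β ∧ β < 0 ∧ γ = β + m := by
    have h0 : 0 ≤ ⌈γ⌉ := by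
      have : -1 < ⌈γ⌉ := by
        have := hγ1.trans_le (Int.le_ceil γ)
        exact_mod_cast this
      omega
    have hcast : ((⌈γ⌉.toNat : ℕ) : ℝ) = (⌈γ⌉ : ℝ) := by
      rw [← Int.cast_natCast, Int.toNat_of_nonneg h0]
    refine ⟨⌈γ⌉.toNat, γ - ⌈γ⌉, by linarith [Int.ceil_lt_add_one γ], ?_, by rw [hcast]; ring⟩
    refine sub_neg.2 (lt_of_le_of_ne (Int.le_ceil γ) fun h => hint ⟨⌈γ⌉, h.symm⟩)
  set F : ℕ → ℝ → ℝ → ℝ := fun j s y => s ^ β * (Real.log s ^ j * ((1 - y) ^ m / (1 + s - y)))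
    with hFdef
  have hF1 : ∀ j s y, F j s y = (1 - y) ^ m * (s ^ β * (Real.log s ^ j * (s + (1 - y))⁻¹)) := by
    intro j s y
    simp only [hFdef, div_eq_mul_inv]
    rw [show s + (1 - y) = 1 + s - y by ring]; ring
  -- At `y = 1` the Stieltjes integral diverges. If `1` is an evaluation point then `γ > 0`, so `m ≥
  -- 1` and the factor `(1 - y) ^ m` makes the integrand zero.
  have hm1 : 0 < γ → m ≠ 0 := by
    rintro h rfl
    simp only [Nat.cast_zero] at hγm
    linarith
  have hFi : ∀ j, ∀ᶠ n in atTop, ∀ y ∈ evalPoints (v n) n x,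
      IntegrableOn (fun s => F j s y) (Ioi 0) := by
    intro j
    filter_upwards [hpt, H.mem] with n hn hmem y hy
    simp only [hF1]
    rcases eq_or_lt_of_le (hmem hy).2 with h | h
    · simp only [h, sub_self, zero_pow (hm1 (hn y hy h)), zero_mul]
      exact integrableOn_zero
    · exact (integrableOn_rpow_log_inv hβ hβ0 (sub_pos.2 h) j).const_mul _
  refine isBigO_of_triangular
    (S := fun j n => interpError (v n) n (fun y => ∫ s in Ioi 0, F j s y) x)
    (c := fun j i => (j.choose i) * logMoment β (fun s => (s + 1)⁻¹) (j - i))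
    (e := fun j n => interpError (v n) n (singPow γ j) x)
    (L := fun j n => Real.log (n : ℝ) ^ j / (n : ℝ) ^ σ) ?_ ?_ ?_
    (fun i j hij => isBigO_log_pow_div_rpow hij le_rfl) j
  · intro j
    filter_upwards [hpt, H.mem] with n hn hmem
    simp only [← interpError_const_mul, ← interpError_sum]
    refine interpError_congr fun y hy => ?_
    rcases eq_or_lt_of_le (hmem hy).2 with h | h
    · have hg := hn y hy h
      simp only [hF1, h, singPow_one hg, sub_self, zero_pow (hm1 hg), zero_mul, mul_zero,
        integral_zero, Finset.sum_const_zero]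
    · have hu : 0 < 1 - y := sub_pos.2 h
      simp only [hF1]
      rw [integral_const_mul, integral_rpow_log_inv hβ hβ0 hu, Finset.mul_sum]
      refine Finset.sum_congr rfl fun i _ => ?_
      rw [singPow, hγm, Real.rpow_add hu, Real.rpow_natCast]
      ring
  · intro j
    simpa using (logMoment_inv_pos hβ hβ0).ne'
  · intro j
    refine isBigO_interpError_integral H hγ hσ j (hFi j) ?_
    obtain ⟨_, _, _, _, hb⟩ := H.bound 0
    filter_upwards [H.injOn, H.root, hb, eventually_ge_atTop m] with n hinj hroot hbn hmn s hs
    simp only [hFdef, interpError_const_mul]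
    rw [interpError_kernel hinj (H.natDegree_le n) hroot (by omega) (hbn s hs).1 (by linarith),
      hγm, Real.rpow_add hs, Real.rpow_natCast]
    simp only [abs_mul, abs_pow]
    rw [abs_of_pos (Real.rpow_pos_of_pos hs _), show |1 - (1 + s)| = s by
      rw [sub_add_cancel_left, abs_neg, abs_of_pos hs]]
    ring

/-- Here `β = 0` and the regularised kernel is used. The density `log s ^ j` reaches `log (1 - y) ^
(j + 1)`, so the rate has one logarithm fewer than the singularity. -/
lemma isBigO_interpError_singPow_natCast (H : KernelBound v ω x a b) (hx : x ≤ 1) {m : ℕ} {σ : ℝ}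
    (hγ : -1 < (m : ℝ) - a) (hσ : σ ≤ 2 * ((m : ℝ) - a) + 2 + b)
    (hpt : ∀ᶠ n in atTop, ∀ y ∈ evalPoints (v n) n x, y = 1 → m ≠ 0) (j : ℕ) :
    (fun n => interpError (v n) n (singPow m (j + 1)) x) =O[atTop]
      fun n : ℕ => Real.log (n : ℝ) ^ j / (n : ℝ) ^ σ := by
  set F : ℕ → ℝ → ℝ → ℝ := fun j s y => s ^ (0 : ℝ) * (Real.log s ^ j *
    ((s + 1)⁻¹ * (1 - y) ^ m - (1 - y) ^ m / (1 + s - y))) with hFdef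
  have hF1 : ∀ j s y, F j s y = (1 - y) ^ m *
      (s ^ (0 : ℝ) * (Real.log s ^ j * ((s + 1)⁻¹ - (s + (1 - y))⁻¹))) := by
    intro j s y
    simp only [hFdef, div_eq_mul_inv]
    rw [show s + (1 - y) = 1 + s - y by ring]; ring
  have hFi : ∀ j, ∀ᶠ n in atTop, ∀ y ∈ evalPoints (v n) n x,
      IntegrableOn (fun s => F j s y) (Ioi 0) := by
    intro j
    filter_upwards [hpt, H.mem] with n hn hmem y hy
    simp only [hF1]
    rcases eq_or_lt_of_le (hmem hy).2 with h | h
    · simp only [h, sub_self, zero_pow (hn y hy h), zero_mul]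
      exact integrableOn_zero
    · exact (integrableOn_log_sub_inv (sub_pos.2 h) j).const_mul _
  refine isBigO_of_triangular
    (S := fun j n => interpError (v n) n (fun y => ∫ s in Ioi 0, F j s y) x)
    (c := fun j i => (j.choose i) * logMoment 0 (fun s => ((s + 1) ^ 2)⁻¹) (j - i) / (i + 1))
    (e := fun j n => interpError (v n) n (singPow m (j + 1)) x)
    (L := fun j n => Real.log (n : ℝ) ^ j / (n : ℝ) ^ σ) ?_ ?_ ?_
    (fun i j hij => isBigO_log_pow_div_rpow hij le_rfl) j
  · intro j
    filter_upwards [hpt, H.mem] with n hn hmem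
    simp only [← interpError_const_mul, ← interpError_sum]
    refine interpError_congr fun y hy => ?_
    rcases eq_or_lt_of_le (hmem hy).2 with h | h
    · have hg := hn y hy h
      have hg' : (0 : ℝ) < m := by exact_mod_cast Nat.pos_of_ne_zero hg
      simp only [hF1, h, singPow_one hg', sub_self, zero_pow hg, zero_mul, mul_zero,
        integral_zero, Finset.sum_const_zero]
    · have hu : 0 < 1 - y := sub_pos.2 h
      simp only [hF1]
      rw [integral_const_mul, integral_log_sub_inv hu, Finset.mul_sum]
      refine Finset.sum_congr rfl fun i _ => ?_
      rw [singPow, Real.rpow_natCast]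
      ring
  · intro j
    have : (j : ℝ) + 1 ≠ 0 := by positivity
    simpa [this] using logMoment_inv_sq_pos.ne'
  · intro j
    refine isBigO_interpError_integral H hγ hσ j (hFi j) ?_
    obtain ⟨_, _, _, _, hb⟩ := H.bound 0
    filter_upwards [H.injOn, H.root, hb, eventually_ge_atTop m] with n hinj hroot hbn hmn s hs
    -- The regularising term is a polynomial in `y` of degree at most `n`, so it does not contribute
    -- to the error.
    have hpoly : interpError (v n) n (fun y => (1 - y) ^ m) x = 0 := by
      have := interpError_polynomial (x := x) hinj (P := (1 - Polynomial.X) ^ m) ?_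
      · simpa using this
      · refine (Polynomial.natDegree_pow_le).trans ?_
        have : (1 - Polynomial.X : Polynomial ℝ).natDegree ≤ 1 :=
          (Polynomial.natDegree_sub_le _ _).trans (by simp)
        nlinarith
    simp only [hFdef, interpError_const_mul, interpError_sub]
    rw [interpError_kernel hinj (H.natDegree_le n) hroot (by omega) (hbn s hs).1 (by linarith),
      hpoly, Real.rpow_zero, Real.rpow_natCast, mul_zero, zero_sub]
    simp only [abs_mul, abs_pow, abs_neg, abs_one]
    rw [show |1 - (1 + s)| = s by rw [sub_add_cancel_left, abs_neg, abs_of_pos hs]]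
    ring

end

/-! ### Smooth remainders: Chebyshev coefficients and aliasing -/

section

lemma continuous_rpow_mul_log_pow {β : ℝ} (hβ : 0 < β) (j : ℕ) :
    Continuous fun u : ℝ => u ^ β * Real.log u ^ j := by
  rw [continuous_iff_continuousAt]
  intro u
  rcases eq_or_ne u 0 with rfl | hu
  · have h1 : Tendsto (fun s : ℝ => s ^ β * Real.log s ^ j) (𝓝[>] 0) (𝓝 0) := by
      have hO : (fun s : ℝ => s ^ β * Real.log s ^ j) =O[𝓝[>] 0] fun s => s ^ (β / 2) := by
        refine ((Asymptotics.isBigO_refl (fun s : ℝ => s ^ β) _).mul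
          (isBigO_log_pow_zero j (half_pos hβ))).congr' EventuallyEq.rfl ?_
        filter_upwards [self_mem_nhdsWithin] with s hs
        rw [← Real.rpow_add hs]
        congr 1; ring
      refine hO.trans_tendsto ?_
      have := (Real.continuousAt_rpow_const 0 (β / 2) (Or.inr (half_pos hβ).le)).tendsto
      rw [Real.zero_rpow (half_pos hβ).ne'] at this
      exact this.mono_left nhdsWithin_le_nhds
    have h2 : Tendsto (fun u : ℝ => |u| ^ β * Real.log |u| ^ j) (𝓝[≠] 0) (𝓝 0) :=
      h1.comp tendsto_abs_nhdsNE_zero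
    rw [continuousAt_iff_punctured_nhds, Real.zero_rpow hβ.ne', zero_mul]
    -- For `u < 0` the real power is not `|u| ^ β`, but it is bounded by it, which gives continuity
    -- from both sides.
    refine squeeze_zero_norm (fun u => ?_) (tendsto_zero_iff_norm_tendsto_zero.1 h2)
    simp only [norm_mul, norm_pow, Real.norm_eq_abs, Real.log_abs]
    refine mul_le_mul_of_nonneg_right ?_ (by positivity)
    exact (Real.abs_rpow_le_abs_rpow u β).trans (le_abs_self _)
  · exact (Real.continuousAt_rpow_const u β (Or.inl hu)).mul ((Real.continuousAt_log hu).pow j)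

/-- At `0` the slope is `u ^ (β - 1) * log u ^ j`, which tends to `0`. For `j = 0` the truncated
exponent `j - 1` is harmless, its coefficient being `j`. -/
lemma hasDerivAt_rpow_mul_log_pow {β : ℝ} (hβ : 1 < β) (j : ℕ) (u : ℝ) :
    HasDerivAt (fun u : ℝ => u ^ β * Real.log u ^ j)
      (β * (u ^ (β - 1) * Real.log u ^ j) + j * (u ^ (β - 1) * Real.log u ^ (j - 1))) u := by
  rcases eq_or_ne u 0 with rfl | hu
  · have hb : β - 1 ≠ 0 := by linarith
    rw [Real.zero_rpow hb, zero_mul, zero_mul, mul_zero, mul_zero, add_zero,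
      hasDerivAt_iff_tendsto_slope]
    have h := (continuous_rpow_mul_log_pow (sub_pos.2 hβ) j).tendsto 0
    rw [Real.zero_rpow hb, zero_mul] at h
    refine (h.mono_left nhdsWithin_le_nhds).congr' ?_
    filter_upwards [self_mem_nhdsWithin] with w hw
    have hw0 : w ≠ 0 := hw
    rw [slope_def_field, Real.zero_rpow (by linarith), zero_mul, sub_zero, sub_zero,
      Real.rpow_sub_one hw0]
    field_simp
  · refine ((Real.hasDerivAt_rpow_const (Or.inl hu)).mul
      ((Real.hasDerivAt_log hu).pow j)).congr_deriv ?_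
    rw [Real.rpow_sub_one hu]
    simp only [Pi.pow_apply]
    field_simp

lemma contDiff_rpow_mul_log_pow (M : ℕ) : ∀ {β : ℝ}, (M : ℝ) < β → ∀ j : ℕ,
    ContDiff ℝ M fun u : ℝ => u ^ β * Real.log u ^ j := by
  induction M with
  | zero =>
    intro β hβ j
    exact contDiff_zero.2 (continuous_rpow_mul_log_pow (by simpa using hβ) j)
  | succ M ih =>
    intro β hβ j
    push_cast at hβ ⊢
    have hβ1 : 1 < β := by
      have : (0 : ℝ) ≤ M := Nat.cast_nonneg M
      linarith
    refine contDiff_succ_iff_deriv.2 ⟨fun u => (hasDerivAt_rpow_mul_log_pow hβ1 j u).differentiableAt,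
      by simp, ?_⟩
    rw [funext fun u => (hasDerivAt_rpow_mul_log_pow hβ1 j u).deriv]
    exact (contDiff_const.mul (ih (by linarith) j)).add
      (contDiff_const.mul (ih (by linarith) (j - 1)))

/-- Repeated integration by parts; periodicity removes the boundary terms. -/
lemma exists_norm_fourierCoeffOn_le (M : ℕ) : ∀ {F : ℝ → ℂ}, F.Periodic (2 * Real.pi) →
    ContDiff ℝ M F → ∃ C, 0 ≤ C ∧ ∀ k : ℤ, k ≠ 0 →
      ‖fourierCoeffOn Real.two_pi_pos F k‖ ≤ C / |(k : ℝ)| ^ M := by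
  induction M with
  | zero =>
    intro F hF hc
    obtain ⟨C, hC⟩ := isCompact_Icc.exists_bound_of_continuousOn (s := Icc 0 (2 * Real.pi))
      hc.continuous.continuousOn
    have hC0 : 0 ≤ C := (norm_nonneg _).trans (hC 0 ⟨le_rfl, Real.two_pi_pos.le⟩)
    refine ⟨C, hC0, fun k _ => ?_⟩
    rw [fourierCoeffOn_eq_integral, norm_smul, pow_zero, div_one]
    have h := intervalIntegral.norm_integral_le_of_norm_le_const (a := 0) (b := 2 * Real.pi)
      (C := C) (f := fun x => (fourier (-k) (x : AddCircle (2 * Real.pi - 0))) • F x) (by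
        intro x hx
        rw [uIoc_of_le Real.two_pi_pos.le] at hx
        rw [norm_smul, fourier_apply, Circle.norm_coe, one_mul]
        exact hC x ⟨hx.1.le, hx.2⟩)
    refine (mul_le_mul_of_nonneg_left h (norm_nonneg _)).trans_eq ?_
    rw [sub_zero, abs_of_pos Real.two_pi_pos, Real.norm_of_nonneg (by positivity)]
    field_simp
  | succ M ih =>
    intro F hF hc
    push_cast at hc
    obtain ⟨hd, -, hc'⟩ := contDiff_succ_iff_deriv.1 hc
    have hper : (deriv F).Periodic (2 * Real.pi) := fun x => by
      rw [← deriv_comp_add_const]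
      congr 1
      exact funext hF
    obtain ⟨C, hC, hb⟩ := ih hper hc'
    refine ⟨C, hC, fun k hk => ?_⟩
    have hk0 : 0 < |(k : ℝ)| := abs_pos.2 (by exact_mod_cast hk)
    rw [fourierCoeffOn_of_hasDerivAt Real.two_pi_pos hk (fun x _ => (hd x).hasDerivAt)
      (hc'.continuous.intervalIntegrable _ _)]
    have h0 : F (2 * Real.pi) - F 0 = 0 := by
      rw [sub_eq_zero]; simpa using hF 0
    rw [h0, mul_zero, zero_sub, norm_mul, norm_neg, norm_mul]
    have h1 : ‖((2 * Real.pi : ℝ) : ℂ) - ((0 : ℝ) : ℂ)‖ = 2 * Real.pi := by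
      rw [Complex.ofReal_zero, sub_zero, Complex.norm_real, Real.norm_of_nonneg Real.two_pi_pos.le]
    have h2 : ‖1 / (-2 * (Real.pi : ℂ) * Complex.I * k)‖ = (2 * Real.pi * |(k : ℝ)|)⁻¹ := by
      simp [abs_of_pos Real.pi_pos]
    rw [h1, h2]
    calc (2 * Real.pi * |(k : ℝ)|)⁻¹ * (2 * Real.pi * ‖fourierCoeffOn Real.two_pi_pos (deriv F) k‖)
        = ‖fourierCoeffOn Real.two_pi_pos (deriv F) k‖ / |(k : ℝ)| := by
          have := Real.pi_pos
          field_simp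
      _ ≤ (C / |(k : ℝ)| ^ M) / |(k : ℝ)| := by gcongr; exact hb k hk
      _ = C / |(k : ℝ)| ^ (M + 1) := by rw [div_div, pow_succ]

/-- Chebyshev expansion, over all integer indices, of a function `f` for which `f ∘ cos` is
smooth. -/
lemma exists_hasSum_chebyshev {f : ℝ → ℝ} {M : ℕ} (hM : 2 ≤ M)
    (hf : ContDiff ℝ M fun θ => f (Real.cos θ)) :
    ∃ (r : ℤ → ℝ) (C : ℝ), 0 ≤ C ∧ (∀ k, k ≠ 0 → |r k| ≤ C / |(k : ℝ)| ^ M) ∧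
      ∀ y ∈ Icc (-1 : ℝ) 1,
        HasSum (fun k : ℤ => r k * (Polynomial.Chebyshev.T ℝ k).eval y) (f y) := by
  set F : ℝ → ℂ := fun θ => (f (Real.cos θ) : ℂ) with hF
  have hFc : ContDiff ℝ M F := Complex.ofRealCLM.contDiff.comp hf
  have hper : F.Periodic (2 * Real.pi) := fun θ => by simp [hF]
  obtain ⟨C, hC, hb⟩ := exists_norm_fourierCoeffOn_le M hper hFc
  have : Fact (0 < 2 * Real.pi) := ⟨Real.two_pi_pos⟩
  let G : C(AddCircle (2 * Real.pi), ℂ) :=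
    ⟨hper.lift, by
      refine continuous_coinduced_dom.2 ?_
      exact hFc.continuous⟩
  have hG : ∀ θ : ℝ, G (θ : AddCircle (2 * Real.pi)) = F θ := fun θ => hper.lift_coe θ
  have hcoef : ∀ k, fourierCoeff G k = fourierCoeffOn Real.two_pi_pos F k := by
    intro k
    rw [fourierCoeff_eq_intervalIntegral _ _ 0, fourierCoeffOn_eq_integral]
    simp only [hG, fourier_coe_apply, sub_zero, zero_add]
  have hsum : Summable (fourierCoeff G) := by
    have h1 : Summable fun k : ℤ => C * (1 / (k : ℝ) ^ 2) :=
      (Real.summable_one_div_int_pow.2 (by norm_num)).mul_left C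
    refine Summable.of_norm_bounded_eventually h1 ?_
    rw [eventually_cofinite]
    refine (finite_singleton (0 : ℤ)).subset fun k hk => ?_
    by_contra hk0
    refine hk ?_
    have hk1 : 1 ≤ |(k : ℝ)| := by
      have := Int.one_le_abs (z := k) hk0
      exact_mod_cast this
    rw [hcoef]
    refine (hb k hk0).trans ?_
    rw [← sq_abs (k : ℝ), mul_one_div]
    gcongr
  refine ⟨fun k => (fourierCoeff G k).re, C, hC, fun k hk => ?_, fun y hy => ?_⟩
  · exact (Complex.abs_re_le_norm _).trans (by rw [hcoef]; exact hb k hk)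
  · set θ := Real.arccos y with hθ
    have hy' : Real.cos θ = y := Real.cos_arccos hy.1 hy.2
    have h1 := has_pointwise_sum_fourier_series_of_summable hsum (θ : AddCircle (2 * Real.pi))
    have h2 := has_pointwise_sum_fourier_series_of_summable hsum ((-θ : ℝ) : AddCircle (2 * Real.pi))
    rw [hG] at h1 h2
    -- `F` is even, so averaging the Fourier series at `θ` and `-θ` replaces the exponentials by
    -- `cos (k θ) = T_k (cos θ)`.
    have h3 := Complex.hasSum_re ((h1.add h2).mul_left (1 / 2))
    have hpi : (Real.pi : ℂ) ≠ 0 := by exact_mod_cast Real.pi_ne_zero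
    convert h3 using 1
    · funext k
      rw [← hy', Polynomial.Chebyshev.T_real_cos, fourier_coe_apply, fourier_coe_apply]
      have e1 : 2 * (Real.pi : ℂ) * Complex.I * k * (θ : ℂ) / ((2 * Real.pi : ℝ) : ℂ)
          = ((k * θ : ℝ) : ℂ) * Complex.I := by push_cast; field_simp
      have e2 : 2 * (Real.pi : ℂ) * Complex.I * k * ((-θ : ℝ) : ℂ) / ((2 * Real.pi : ℝ) : ℂ)
          = -((k * θ : ℝ) : ℂ) * Complex.I := by push_cast; field_simp
      rw [e1, e2, smul_eq_mul, smul_eq_mul, ← mul_add, ← Complex.two_cos, ← Complex.ofReal_cos]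
      rw [show (1 / 2 : ℂ) * (fourierCoeff G k * (2 * ((Real.cos (k * θ) : ℝ) : ℂ)))
        = fourierCoeff G k * ((Real.cos (k * θ) : ℝ) : ℂ) by ring, Complex.re_mul_ofReal]
    · have : F (-θ) = F θ := by simp [hF]
      rw [this, ← hy']
      rw [show (1 / 2 : ℂ) * (F θ + F θ) = F θ by ring]
      simp [hF]

/-- Interpolation error of a function `f` for which `f ∘ cos` is smooth. -/
lemma isBigO_interpError_of_contDiff {v : ℕ → ℕ → ℝ} {x : ℝ}
    (hinj : ∀ᶠ n in atTop, InjOn (v n) (Finset.range (n + 1)))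
    (hmem : ∀ᶠ n in atTop, evalPoints (v n) n x ⊆ Icc (-1) 1)
    (halias : ∀ᶠ n in atTop, ∀ k : ℤ,
      |interpError (v n) n (fun y => (Polynomial.Chebyshev.T ℝ k).eval y) x| ≤ 2)
    {f : ℝ → ℝ} {M : ℕ} (hf : ContDiff ℝ (M + 2 : ℕ) fun θ => f (Real.cos θ)) :
    (fun n => interpError (v n) n f x) =O[atTop] fun n : ℕ => ((n : ℝ) ^ M)⁻¹ := by
  obtain ⟨r, C, hC, hr, hsum⟩ := exists_hasSum_chebyshev (by omega) hf
  have hS : Summable fun k : ℤ => 1 / (k : ℝ) ^ 2 := Real.summable_one_div_int_pow.2 (by norm_num)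
  refine Asymptotics.IsBigO.of_bound (2 * C * ∑' k : ℤ, 1 / (k : ℝ) ^ 2) ?_
  filter_upwards [hinj, hmem, halias, eventually_ge_atTop 1] with n hn hm ha hn1
  have hn0 : (0 : ℝ) < n := by exact_mod_cast hn1
  have h1 := interpError_hasSum (F := fun (k : ℤ) y => r k * (Polynomial.Chebyshev.T ℝ k).eval y)
    fun y hy => hsum y (hm hy)
  rw [← h1.tsum_eq, Real.norm_of_nonneg (inv_nonneg.2 (by positivity)), mul_right_comm]
  rw [← tsum_mul_left]
  refine tsum_of_norm_bounded (hS.mul_left _).hasSum fun k => ?_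
  rw [interpError_const_mul, norm_mul, Real.norm_eq_abs, Real.norm_eq_abs]
  -- Degrees up to `n` are reproduced exactly. For the others `|k| ^ (-M) ≤ n ^ (-M)`, and the
  -- remaining `k ^ (-2)` is summable.
  by_cases hk : k.natAbs ≤ n
  · rw [interpError_polynomial hn (by rw [Polynomial.Chebyshev.natDegree_T]; exact hk), abs_zero,
      mul_zero]
    positivity
  · have hk0 : k ≠ 0 := by rintro rfl; simp at hk
    have hkn : (n : ℝ) ≤ |(k : ℝ)| := by
      have : (n : ℤ) ≤ |k| := by rw [Int.abs_eq_natAbs]; omega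
      exact_mod_cast this
    calc |r k| * _ ≤ (C / |(k : ℝ)| ^ (M + 2)) * 2 := by
          gcongr
          · exact hr k hk0
          · exact ha k
      _ = 2 * C * (|(k : ℝ)| ^ M)⁻¹ * (1 / (k : ℝ) ^ 2) := by
          rw [pow_add, sq_abs]; field_simp
      _ ≤ _ := by gcongr

end

/-! ### Chebyshev polynomials: growth beyond `1`, aliasing, and kernel bounds at both kinds of nodes
-/

section

open Polynomial.Chebyshev (T T_real_cos T_real_cosh natDegree_T abs_eval_T_real_le_one)

lemma nat_mul_sinh_le {y : ℝ} (hy : 0 ≤ y) (M : ℕ) : M * Real.sinh y ≤ Real.sinh (M * y) := by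
  induction M with
  | zero => simp
  | succ M ih =>
    have h0 : 0 ≤ Real.sinh y := Real.sinh_nonneg_iff.2 hy
    have h1 : 0 ≤ Real.sinh (M * y) := Real.sinh_nonneg_iff.2 (by positivity)
    push_cast
    rw [add_mul, one_mul, add_mul, one_mul, Real.sinh_add]
    nlinarith [Real.one_le_cosh y, Real.one_le_cosh (M * y)]

lemma cosh_pow_le {y : ℝ} (hy : 0 ≤ y) (K : ℕ) : Real.cosh y ^ K ≤ Real.cosh (K * y) := by
  induction K with
  | zero => simp
  | succ K ih =>
    have h0 : 0 ≤ Real.sinh y := Real.sinh_nonneg_iff.2 hy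
    have h1 : 0 ≤ Real.sinh (K * y) := Real.sinh_nonneg_iff.2 (by positivity)
    push_cast
    rw [add_mul, one_mul, Real.cosh_add, pow_succ]
    nlinarith [Real.one_le_cosh y, mul_nonneg h1 h0]

/-- Put `1 + s = cosh η`. From `cosh z = 1 + 2 sinh² (z / 2)` and `sinh (M z) ≥ M sinh z` follows
`cosh (M η) ≥ 1 + M² s`; then `cosh_pow_le` supplies the power. -/
lemma pow_le_eval_T {s : ℝ} (hs : 0 < s) {K M N : ℕ} (hN : K * M ≤ N) :
    (1 + (M : ℝ) ^ 2 * s) ^ K ≤ (T ℝ N).eval (1 + s) := by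
  set η := Real.arcosh (1 + s) with hη
  have hη0 : 0 ≤ η := Real.arcosh_nonneg (by linarith)
  have hc : Real.cosh η = 1 + s := Real.cosh_arcosh (by linarith)
  have h1 : 1 + (M : ℝ) ^ 2 * s ≤ Real.cosh (M * η) := by
    have hsq : ∀ z : ℝ, Real.cosh z = 1 + 2 * Real.sinh (z / 2) ^ 2 := fun z => by
      have := Real.cosh_two_mul (z / 2)
      rw [mul_div_cancel₀ z two_ne_zero, Real.cosh_sq] at this
      linarith
    have h2 := nat_mul_sinh_le (half_pos (lt_of_le_of_ne hη0 fun h => by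
      rw [← h, Real.cosh_zero] at hc; linarith)).le M
    have h3 : 0 ≤ Real.sinh (η / 2) := Real.sinh_nonneg_iff.2 (by linarith)
    have h4 := pow_le_pow_left₀ (by positivity) h2 2
    have h5 := hsq η
    rw [hsq (M * η), mul_div_assoc]
    rw [mul_pow] at h4
    have h6 : s = 2 * Real.sinh (η / 2) ^ 2 := by linarith
    rw [h6]
    linarith
  rw [← hc, T_real_cosh, Int.cast_natCast]
  calc (1 + (M : ℝ) ^ 2 * s) ^ K ≤ Real.cosh (M * η) ^ K := by gcongr
    _ ≤ Real.cosh (K * (M * η)) := cosh_pow_le (by positivity) K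
    _ ≤ Real.cosh (N * η) := by
      rw [Real.cosh_le_cosh, abs_of_nonneg (by positivity), abs_of_nonneg (by positivity),
        ← mul_assoc]
      gcongr
      exact_mod_cast hN

/-- Rapid growth of Chebyshev polynomials to the right of `1`. -/
lemma exists_pow_le_eval_T (K : ℕ) : ∃ c : ℝ, 0 < c ∧ ∀ᶠ n : ℕ in atTop, ∀ N : ℕ, n / 2 ≤ N →
    ∀ s : ℝ, 0 < s → (1 + c * ((n : ℝ) ^ 2 * s)) ^ K ≤ (T ℝ N).eval (1 + s) := by
  -- With `M = N / (K + 1)`, the conditions `N ≥ n / 2` and `n ≥ 4 (K + 1)` give `n ≤ 4 (K + 1) M`;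
  -- squaring produces the constant.
  refine ⟨1 / (16 * ((K : ℝ) + 1) ^ 2), by positivity, ?_⟩
  filter_upwards [eventually_ge_atTop (4 * (K + 1))] with n hn N hN s hs
  set M := N / (K + 1) with hM
  have h1 : n ≤ 4 * ((K + 1) * M) := by
    have := Nat.div_add_mod N (K + 1)
    have := Nat.mod_lt N (by omega : K + 1 > 0)
    rw [← hM] at *
    omega
  have h2 : (n : ℝ) ≤ 4 * (((K : ℝ) + 1) * M) := by exact_mod_cast h1
  have h3 : 1 / (16 * ((K : ℝ) + 1) ^ 2) * ((n : ℝ) ^ 2 * s) ≤ (M : ℝ) ^ 2 * s := by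
    rw [← mul_assoc]
    refine mul_le_mul_of_nonneg_right ?_ hs.le
    rw [one_div_mul_eq_div, div_le_iff₀ (by positivity)]
    calc (n : ℝ) ^ 2 ≤ (4 * (((K : ℝ) + 1) * M)) ^ 2 := by gcongr
      _ = _ := by ring
  refine le_trans ?_ (pow_le_eval_T hs (K := K + 1) (M := M) (Nat.mul_div_le N (K + 1)))
  have h4 : 1 ≤ 1 + (M : ℝ) ^ 2 * s := by
    have : 0 ≤ (M : ℝ) ^ 2 * s := by positivity
    linarith
  calc _ ≤ (1 + (M : ℝ) ^ 2 * s) ^ K := by gcongr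
    _ ≤ _ := pow_le_pow_right₀ h4 (Nat.le_succ K)

/-- Aliasing: `T_k` coincides at the nodes with `ε T_r` of degree at most `n`, which is therefore
its interpolant. Both are bounded by `1` on `[-1, 1]`. -/
lemma abs_interpError_T_le {v : ℕ → ℝ} {n : ℕ} {x : ℝ} (hv : InjOn v (Finset.range (n + 1)))
    (hx : x ∈ Icc (-1 : ℝ) 1) (k : ℤ) {ε : ℝ} {r : ℤ} (hε : |ε| ≤ 1) (hr : r.natAbs ≤ n)
    (h : ∀ j ∈ Finset.range (n + 1), (T ℝ k).eval (v j) = ε * (T ℝ r).eval (v j)) :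
    |interpError v n (fun y => (T ℝ k).eval y) x| ≤ 2 := by
  have hx' : |x| ≤ 1 := abs_le.2 hx
  rw [interpError_eq_sub_eval hv (P := Polynomial.C ε * T ℝ r)]
  · rw [Polynomial.eval_mul, Polynomial.eval_C]
    have h1 := abs_eval_T_real_le_one k hx'
    have h2 := abs_eval_T_real_le_one r hx'
    have h3 : |ε * (T ℝ r).eval x| ≤ 1 := by
      rw [abs_mul]; exact mul_le_one₀ hε (abs_nonneg _) h2
    have h4 := abs_sub ((T ℝ k).eval x) (ε * (T ℝ r).eval x)
    linarith
  · exact (Polynomial.natDegree_C_mul_le _ _).trans (by rw [natDegree_T]; exact hr)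
  · intro j hj
    rw [Polynomial.eval_mul, Polynomial.eval_C, h j hj]

/-! ### Points of the first kind -/

lemma firstNode_angle_mem {n j : ℕ} (hj : j ∈ Finset.range (n + 1)) :
    (2 * (j : ℝ) + 1) / (2 * (n : ℝ) + 2) * Real.pi ∈ Ioo 0 Real.pi := by
  have h : (j : ℝ) ≤ n := by exact_mod_cast Nat.lt_succ_iff.1 (Finset.mem_range.1 hj)
  have hlt : (2 * (j : ℝ) + 1) / (2 * (n : ℝ) + 2) < 1 := by
    rw [div_lt_one (by positivity)]; linarith
  exact ⟨by positivity, by nlinarith [Real.pi_pos]⟩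

lemma injOn_firstNode (n : ℕ) : InjOn (firstNode n) (Finset.range (n + 1)) := by
  intro i hi j hj hij
  have h := Real.injOn_cos (Ioo_subset_Icc_self (firstNode_angle_mem hi))
    (Ioo_subset_Icc_self (firstNode_angle_mem hj)) hij
  have h1 : (2 * (n : ℝ) + 2) ≠ 0 := by positivity
  have h2 := mul_right_cancel₀ Real.pi_ne_zero h
  rw [div_left_inj' h1] at h2
  have h3 : (i : ℝ) = j := by linarith
  exact_mod_cast h3

lemma firstNode_lt_one {n j : ℕ} (hj : j ∈ Finset.range (n + 1)) : firstNode n j < 1 := by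
  have h := firstNode_angle_mem hj
  rw [firstNode]
  refine lt_of_lt_of_eq ?_ Real.cos_zero
  exact Real.strictAntiOn_cos ⟨le_rfl, Real.pi_pos.le⟩ (Ioo_subset_Icc_self h) h.1

lemma evalPoints_firstNode_subset {x : ℝ} (hx : x ∈ Icc (-1 : ℝ) 1) (n : ℕ) :
    evalPoints (firstNode n) n x ⊆ Icc (-1) 1 := by
  rintro y (rfl | ⟨j, -, rfl⟩)
  · exact hx
  · exact ⟨Real.neg_one_le_cos _, Real.cos_le_one _⟩

/-- The index shift adds `q (2 j + 1) π` to the angle; as `2 j + 1` is odd, the sign does not depend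
on `j`. -/
lemma eval_T_firstNode_add (n j : ℕ) (r q : ℤ) :
    (T ℝ (r + 2 * ((n + 1 : ℕ) : ℤ) * q)).eval (firstNode n j)
      = (-1) ^ q * (T ℝ r).eval (firstNode n j) := by
  rw [firstNode, T_real_cos, T_real_cos]
  set θ := (2 * (j : ℝ) + 1) / (2 * (n : ℝ) + 2) * Real.pi with hθ
  have h : ((r + 2 * ((n + 1 : ℕ) : ℤ) * q : ℤ) : ℝ) * θ
      = r * θ + ((q * (2 * j + 1) : ℤ) : ℝ) * Real.pi := by
    rw [hθ]; push_cast; field_simp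
  rw [h, Real.cos_add_int_mul_pi, zpow_mul]
  congr 1
  rcases Int.even_or_odd q with hq | hq
  · rw [hq.neg_one_zpow, one_zpow]
  · rw [hq.neg_one_zpow, Odd.neg_one_zpow ⟨(j : ℤ), rfl⟩]

lemma eval_T_firstNode (n j : ℕ) : (T ℝ ((n + 1 : ℕ) : ℤ)).eval (firstNode n j) = 0 := by
  rw [firstNode, T_real_cos, Real.cos_eq_zero_iff]
  exact ⟨j, by push_cast; field_simp⟩

lemma abs_interpError_T_firstNode_le {x : ℝ} (hx : x ∈ Icc (-1 : ℝ) 1) (n : ℕ) (k : ℤ) :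
    |interpError (firstNode n) n (fun y => (T ℝ k).eval y) x| ≤ 2 := by
  have hpos : 0 < 2 * (n + 1) := by omega
  have h1 := Int.bmod_add_bdiv k (2 * (n + 1))
  have h2 := Int.le_bmod (x := k) hpos
  have h3 := Int.bmod_le (x := k) hpos
  set r := Int.bmod k (2 * (n + 1)) with hr
  set q := Int.bdiv k (2 * (n + 1)) with hq
  have hk : k = r + 2 * ((n + 1 : ℕ) : ℤ) * q := by rw [← h1]; push_cast; ring
  have hrN : r.natAbs ≤ n + 1 := by push_cast at h2 h3; omega
  -- The balanced residue may be `±(n + 1)`, one degree too high; then `T_r` vanishes at all nodes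
  -- and the interpolant is `0`.
  rcases hrN.eq_or_lt with h | h
  · refine abs_interpError_T_le (injOn_firstNode n) hx k (ε := 0) (r := 0) (by simp) (by simp)
      fun j _ => ?_
    rw [hk, eval_T_firstNode_add, ← Polynomial.Chebyshev.T_natAbs ℝ r, h, eval_T_firstNode,
      mul_zero, zero_mul]
  · refine abs_interpError_T_le (injOn_firstNode n) hx k (ε := (-1) ^ q) (r := r)
      (by rw [abs_zpow, abs_neg, abs_one, one_zpow]) (by omega) fun j _ => ?_
    rw [hk, eval_T_firstNode_add]

lemma kernelBound_firstNode_of_lt {x : ℝ} (hx : x ∈ Ico (-1 : ℝ) 1) :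
    KernelBound firstNode (fun n => T ℝ ((n + 1 : ℕ) : ℤ)) x 0 0 where
  injOn := Eventually.of_forall injOn_firstNode
  natDegree_le n := by rw [natDegree_T]; rfl
  root := Eventually.of_forall fun n j _ => eval_T_firstNode n j
  mem := Eventually.of_forall (evalPoints_firstNode_subset (Ico_subset_Icc_self hx))
  bound K := by
    have hx1 : 0 < 1 - x := sub_pos.2 hx.2
    obtain ⟨c, hc, hcn⟩ := exists_pow_le_eval_T K
    refine ⟨(1 - x)⁻¹, by positivity, c, hc, ?_⟩
    filter_upwards [hcn] with n hn s hs
    have h := hn (n + 1) (by omega) s hs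
    have h0 : 0 < (1 + c * ((n : ℝ) ^ 2 * s)) ^ K := by positivity
    have hT := abs_eval_T_real_le_one ((n + 1 : ℕ) : ℤ) (abs_le.2 (Ico_subset_Icc_self hx))
    refine ⟨(h0.trans_le h).ne', ?_⟩
    rw [abs_div, abs_of_pos (mul_pos (h0.trans_le h) (by linarith : 0 < 1 + s - x)), neg_zero,
      Real.rpow_zero, Real.rpow_zero, mul_one, one_mul]
    calc _ ≤ 1 / ((1 + c * ((n : ℝ) ^ 2 * s)) ^ K * (1 - x)) := by
          gcongr
          · exact (h0.trans_le h).le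
          · linarith only [hs]
      _ = _ := by rw [one_div, mul_inv, mul_comm]

/-- At `x = 1` the factor `1 + s - x` is `s` itself, no longer bounded below: hence `a = 1`, and one
factor `n` is lost against the claimed rate at other points. -/
lemma kernelBound_firstNode_one :
    KernelBound firstNode (fun n => T ℝ ((n + 1 : ℕ) : ℤ)) 1 1 0 where
  injOn := Eventually.of_forall injOn_firstNode
  natDegree_le n := by rw [natDegree_T]; rfl
  root := Eventually.of_forall fun n j _ => eval_T_firstNode n j
  mem := Eventually.of_forall (evalPoints_firstNode_subset ⟨by norm_num, le_rfl⟩)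
  bound K := by
    obtain ⟨c, hc, hcn⟩ := exists_pow_le_eval_T K
    refine ⟨1, zero_le_one, c, hc, ?_⟩
    filter_upwards [hcn] with n hn s hs
    have h := hn (n + 1) (by omega) s hs
    have h0 : 0 < (1 + c * ((n : ℝ) ^ 2 * s)) ^ K := by positivity
    refine ⟨(h0.trans_le h).ne', ?_⟩
    rw [Polynomial.Chebyshev.T_eval_one, abs_div, abs_one, add_sub_cancel_left,
      abs_of_pos (mul_pos (h0.trans_le h) hs), neg_zero, Real.rpow_zero, mul_one, one_mul,
      Real.rpow_neg_one]
    calc _ ≤ 1 / ((1 + c * ((n : ℝ) ^ 2 * s)) ^ K * s) := by gcongr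
      _ = _ := by rw [one_div, mul_inv, mul_comm]

/-! ### Points of the second kind -/

open Polynomial.Chebyshev (node node_mem_Icc strictAntiOn_node)

lemma injOn_node (n : ℕ) : InjOn (node n) (Finset.range (n + 1)) := (strictAntiOn_node n).injOn

lemma evalPoints_node_subset {x : ℝ} (hx : x ∈ Icc (-1 : ℝ) 1) (n : ℕ) :
    evalPoints (node n) n x ⊆ Icc (-1) 1 := by
  rintro y (rfl | ⟨j, -, rfl⟩)
  · exact hx
  · exact node_mem_Icc

lemma abs_interpError_T_node_le {x : ℝ} (hx : x ∈ Icc (-1 : ℝ) 1) {n : ℕ} (hn : 0 < n) (k : ℤ) :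
    |interpError (node n) n (fun y => (T ℝ k).eval y) x| ≤ 2 := by
  have hpos : 0 < 2 * n := by omega
  have h1 := Int.bmod_add_bdiv k (2 * n)
  have h2 := Int.le_bmod (x := k) hpos
  have h3 := Int.bmod_le (x := k) hpos
  set r := Int.bmod k (2 * n) with hr
  set q := Int.bdiv k (2 * n) with hq
  refine abs_interpError_T_le (injOn_node n) hx k (ε := 1) (r := r) (by simp)
    (by push_cast at h2 h3; omega) fun j _ => ?_
  have hn0 : (n : ℝ) ≠ 0 := by exact_mod_cast hn.ne'
  rw [one_mul, node, T_real_cos, T_real_cos, ← h1]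
  have h : ((r + (2 * n : ℕ) * q : ℤ) : ℝ) * (j * Real.pi / n)
      = r * (j * Real.pi / n) + ((q * j : ℤ) : ℝ) * (2 * Real.pi) := by
    push_cast; field_simp
  rw [h, Real.cos_add_int_mul_two_pi]

lemma eval_T_sub_T_cos (n : ℕ) (θ : ℝ) :
    (T ℝ ((n : ℤ) + 1) - T ℝ ((n : ℤ) - 1)).eval (Real.cos θ)
      = -2 * Real.sin (n * θ) * Real.sin θ := by
  rw [Polynomial.eval_sub, T_real_cos, T_real_cos]
  push_cast
  rw [add_mul, sub_mul, one_mul, Real.cos_add, Real.cos_sub]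
  ring

/-- The right side is `2 sinh (n η) sinh η` with `cosh η = 1 + s`. Splitting `n = p + q` into
halves, `sinh (p η) ≥ p sinh η` yields the factor `n s`, while `cosh (q η)` keeps the rapid growth.
-/
lemma le_eval_T_sub_T (n : ℕ) {s : ℝ} (hs : 0 < s) :
    2 * n * s * (T ℝ ((n / 2 : ℕ) : ℤ)).eval (1 + s)
      ≤ (T ℝ ((n : ℤ) + 1) - T ℝ ((n : ℤ) - 1)).eval (1 + s) := by
  set η := Real.arcosh (1 + s) with hη
  have hη0 : 0 ≤ η := Real.arcosh_nonneg (by linarith)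
  have hc : Real.cosh η = 1 + s := Real.cosh_arcosh (by linarith)
  set p := (n + 1) / 2 with hp
  set q := n / 2 with hq
  have hpq : (n : ℝ) = p + q := by
    have : n = p + q := by omega
    exact_mod_cast this
  have hp2 : (n : ℝ) ≤ 2 * p := by
    have : n ≤ 2 * p := by omega
    exact_mod_cast this
  have h1 : (T ℝ ((n : ℤ) + 1) - T ℝ ((n : ℤ) - 1)).eval (1 + s)
      = 2 * Real.sinh (n * η) * Real.sinh η := by
    rw [← hc, Polynomial.eval_sub, T_real_cosh, T_real_cosh]
    push_cast
    rw [add_mul, sub_mul, one_mul, Real.cosh_add, Real.cosh_sub]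
    ring
  have hs0 : 0 ≤ Real.sinh η := Real.sinh_nonneg_iff.2 hη0
  have hsq : 2 * s ≤ Real.sinh η ^ 2 := by
    rw [Real.sinh_sq, hc]; nlinarith
  have hq1 := Real.one_le_cosh (q * η)
  have hsn : p * Real.sinh η * Real.cosh (q * η) ≤ Real.sinh (n * η) := by
    rw [hpq, add_mul, Real.sinh_add]
    have h2 := mul_le_mul_of_nonneg_right (nat_mul_sinh_le hη0 p) (by linarith : 0 ≤ Real.cosh (q * η))
    have h3 : 0 ≤ Real.cosh (p * η) * Real.sinh (q * η) :=
      mul_nonneg (Real.cosh_pos _).le (Real.sinh_nonneg_iff.2 (by positivity))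
    linarith
  rw [h1, ← hc, T_real_cosh, Int.cast_natCast]
  calc 2 * n * s * Real.cosh (q * η) ≤ 2 * (2 * p) * s * Real.cosh (q * η) := by gcongr
    _ = 2 * p * (2 * s) * Real.cosh (q * η) := by ring
    _ ≤ 2 * p * (Real.sinh η ^ 2) * Real.cosh (q * η) := by gcongr
    _ = 2 * (p * Real.sinh η * Real.cosh (q * η)) * Real.sinh η := by ring
    _ ≤ _ := by gcongr

lemma kernelBound_node {x : ℝ} (hx : x ∈ Ico (-1 : ℝ) 1) :
    KernelBound node (fun n => T ℝ ((n : ℤ) + 1) - T ℝ ((n : ℤ) - 1)) x 1 1 where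
  injOn := Eventually.of_forall injOn_node
  natDegree_le n := by
    refine (Polynomial.natDegree_sub_le _ _).trans ?_
    rw [natDegree_T, natDegree_T]
    omega
  root := by
    filter_upwards [eventually_gt_atTop 0] with n hn j _
    have hn0 : (n : ℝ) ≠ 0 := by exact_mod_cast hn.ne'
    rw [node, eval_T_sub_T_cos, mul_div_cancel₀ _ hn0, Real.sin_nat_mul_pi, mul_zero, zero_mul]
  mem := Eventually.of_forall (evalPoints_node_subset (Ico_subset_Icc_self hx))
  bound K := by
    have hx1 : 0 < 1 - x := sub_pos.2 hx.2
    obtain ⟨c, hc, hcn⟩ := exists_pow_le_eval_T K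
    refine ⟨(1 - x)⁻¹, by positivity, c, hc, ?_⟩
    filter_upwards [hcn, eventually_gt_atTop 0] with n hn hnpos s hs
    have hn0 : (0 : ℝ) < n := by exact_mod_cast hnpos
    have h := hn (n / 2) le_rfl s hs
    have h0 : 0 < (1 + c * ((n : ℝ) ^ 2 * s)) ^ K := by positivity
    have hω : 2 * n * s * (1 + c * ((n : ℝ) ^ 2 * s)) ^ K
        ≤ (T ℝ ((n : ℤ) + 1) - T ℝ ((n : ℤ) - 1)).eval (1 + s) :=
      (mul_le_mul_of_nonneg_left h (by positivity)).trans (le_eval_T_sub_T n hs)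
    have hωx : |(T ℝ ((n : ℤ) + 1) - T ℝ ((n : ℤ) - 1)).eval x| ≤ 2 := by
      have hxa := abs_le.2 (Ico_subset_Icc_self hx)
      rw [Polynomial.eval_sub]
      have h4 := abs_sub ((T ℝ ((n : ℤ) + 1)).eval x) ((T ℝ ((n : ℤ) - 1)).eval x)
      linarith [abs_eval_T_real_le_one ((n : ℤ) + 1) hxa, abs_eval_T_real_le_one ((n : ℤ) - 1) hxa]
    have hpos : 0 < 2 * n * s * (1 + c * ((n : ℝ) ^ 2 * s)) ^ K := by positivity
    refine ⟨(hpos.trans_le hω).ne', ?_⟩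
    rw [abs_div, abs_of_pos (mul_pos (hpos.trans_le hω) (by linarith : 0 < 1 + s - x)),
      Real.rpow_neg_one, Real.rpow_neg_one]
    calc _ ≤ 2 / (2 * n * s * (1 + c * ((n : ℝ) ^ 2 * s)) ^ K * (1 - x)) := by
          gcongr
          · exact (hpos.trans_le hω).le
          · linarith only [hs]
      _ = _ := by field_simp

end

/-! ### General analytic factors, reflection, and the error rates -/

section

lemma analyticAt_dslope {g : ℝ → ℝ} {z y : ℝ} (hz : AnalyticAt ℝ g z) (hy : AnalyticAt ℝ g y) :
    AnalyticAt ℝ (dslope g z) y := by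
  rcases eq_or_ne y z with rfl | hne
  · obtain ⟨p, hp⟩ := hz
    exact ⟨_, hp.has_fpower_series_dslope_fslope⟩
  · refine AnalyticAt.congr ?_ (dslope_eventuallyEq_slope_of_ne g hne).symm
    have h : AnalyticAt ℝ (fun w => (w - z)⁻¹ * (g w - g z)) y :=
      ((analyticAt_id.sub analyticAt_const).inv (sub_ne_zero.2 hne)).mul (hy.sub analyticAt_const)
    exact h.congr (Eventually.of_forall fun w => by simp [slope_def_field, div_eq_inv_mul])

/-- One Taylor step `g(y) = g(1) + (y - 1) dslope g 1 y`; the remainder has exponent `γ + 1`. At `y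
= 1` every term vanishes for any `γ`, since `Real.log 0 = 0` and `μ ≠ 0`. -/
lemma rightSing_eq_singPow_sub {γ : ℝ} {μ : ℕ} (hμ : μ ≠ 0) (g : ℝ → ℝ) {y : ℝ} (hy : y ≤ 1) :
    rightSing γ μ g y = g 1 * singPow γ μ y - rightSing (γ + 1) μ (dslope g 1) y := by
  rcases eq_or_lt_of_le hy with rfl | h
  · simp [rightSing, singPow, hμ]
  · have h0 : 0 < 1 - y := sub_pos.2 h
    have h1 := sub_smul_dslope g 1 y
    rw [smul_eq_mul] at h1
    have h2 : g y = g 1 + (y - 1) * dslope g 1 y := by linarith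
    rw [rightSing, h2, singPow, rightSing, Real.rpow_add_one h0.ne']
    ring

lemma contDiff_rightSing_cos {γ : ℝ} {M : ℕ} (hγ : (M : ℝ) < γ) (μ : ℕ) {g : ℝ → ℝ}
    (hg : AnalyticOnNhd ℝ g (Icc (-1) 1)) :
    ContDiff ℝ M fun θ => rightSing γ μ g (Real.cos θ) := by
  refine ContDiff.mul ?_ ?_
  · exact (contDiff_rpow_mul_log_pow M hγ μ).comp (contDiff_const.sub Real.contDiff_cos)
  · rw [contDiff_iff_contDiffAt]
    intro θ
    exact (hg (Real.cos θ) ⟨Real.neg_one_le_cos θ, Real.cos_le_one θ⟩).contDiffAt.comp θ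
      Real.contDiff_cos.contDiffAt

section Rate

variable {v : ℕ → ℕ → ℝ} {ω : ℕ → Polynomial ℝ} {x a b : ℝ}

/-- `K` counts the Taylor steps. When none remain the exponent exceeds `M + 2`, and the smooth
estimate gives `n ^ (-M)` with `M ≥ σ`. -/
lemma isBigO_interpError_rightSing (H : KernelBound v ω x a b)
    (halias : ∀ᶠ n in atTop, ∀ k : ℤ,
      |interpError (v n) n (fun y => (Polynomial.Chebyshev.T ℝ k).eval y) x| ≤ 2)
    {μ l M : ℕ} (hμ : μ ≠ 0) {σ : ℝ} (hσ : σ ≤ M) (K : ℕ) : ∀ {γ : ℝ} {g : ℝ → ℝ},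
    AnalyticOnNhd ℝ g (Icc (-1) 1) → (M : ℝ) + 2 < γ + K →
    (∀ k : ℕ, (fun n => interpError (v n) n (singPow (γ + k) μ) x) =O[atTop]
      fun n : ℕ => Real.log (n : ℝ) ^ l / (n : ℝ) ^ σ) →
    (fun n => interpError (v n) n (rightSing γ μ g) x) =O[atTop]
      fun n : ℕ => Real.log (n : ℝ) ^ l / (n : ℝ) ^ σ := by
  induction K with
  | zero =>
    intro γ g hg hM _
    rw [Nat.cast_zero, add_zero] at hM
    have h := isBigO_interpError_of_contDiff H.injOn H.mem halias
      (contDiff_rightSing_cos (M := M + 2) (by push_cast; exact hM) μ hg)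
    refine h.trans ((isBigO_log_pow_div_rpow (Nat.zero_le l) hσ).congr_left fun n => ?_)
    rw [pow_zero, Real.rpow_natCast, one_div]
  | succ K ih =>
    intro γ g hg hM hpure
    have hg1 : AnalyticOnNhd ℝ (dslope g 1) (Icc (-1) 1) := fun y hy =>
      analyticAt_dslope (hg 1 ⟨by norm_num, le_rfl⟩) (hg y hy)
    have h1 := ih (γ := γ + 1) hg1 (by push_cast at hM; linarith) fun k => by
      have := hpure (k + 1)
      push_cast at this
      rwa [show γ + 1 + (k : ℝ) = γ + (k + 1) by ring]
    have h0 := hpure 0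
    rw [Nat.cast_zero, add_zero] at h0
    refine ((h0.const_mul_left (g 1)).sub h1).congr' ?_ EventuallyEq.rfl
    filter_upwards [H.mem] with n hn
    rw [← interpError_const_mul, ← interpError_sub]
    exact (interpError_congr fun y hy => rightSing_eq_singPow_sub hμ g (hn hy).2).symm

lemma isInteger_add_natCast {γ : ℝ} {k : ℕ} : IsInteger (γ + k) ↔ IsInteger γ := by
  constructor
  · rintro ⟨m, hm⟩
    exact ⟨m - k, by push_cast; linarith⟩
  · rintro ⟨m, hm⟩
    exact ⟨m + k, by push_cast; linarith⟩

lemma errorRate_rightSing (H : KernelBound v ω x a b) (hx : x ≤ 1)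
    (halias : ∀ᶠ n in atTop, ∀ k : ℤ,
      |interpError (v n) n (fun y => (Polynomial.Chebyshev.T ℝ k).eval y) x| ≤ 2)
    {γ σ : ℝ} (hγ1 : -1 < γ) (hγ : -1 < γ - a) (hσ : σ ≤ 2 * (γ - a) + 2 + b)
    (hpt : ∀ᶠ n in atTop, ∀ y ∈ evalPoints (v n) n x, y = 1 → 0 < γ)
    {μ : ℕ} (hμ : μ ≠ 0) {g : ℝ → ℝ} (hg : AnalyticOnNhd ℝ g (Icc (-1) 1)) :
    ErrorRate γ μ (rightSing γ μ g) (fun n => Lagrange.interpolate (Finset.range (n + 1)) (v n)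
      (fun j => rightSing γ μ g (v n j))) x σ := by
  obtain ⟨M, hM⟩ := exists_nat_ge σ
  obtain ⟨K, hK⟩ := exists_nat_gt ((M : ℝ) + 2 - γ)
  have hk : ∀ k : ℕ, (0 : ℝ) ≤ k := fun k => Nat.cast_nonneg k
  have hpt' : ∀ k : ℕ, ∀ᶠ n in atTop, ∀ y ∈ evalPoints (v n) n x, y = 1 → 0 < γ + k := fun k => by
    filter_upwards [hpt] with n hn y hy h1
    linarith [hn y hy h1, hk k]
  refine ⟨fun hint => ?_, fun hint => ?_⟩
  · refine isBigO_interpError_rightSing H halias hμ hM K hg (by linarith) fun k => ?_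
    exact isBigO_interpError_singPow_of_not_integer H hx (by linarith [hk k]) (by linarith [hk k])
      (fun h => hint (isInteger_add_natCast.1 h)) (by linarith [hk k]) (hpt' k) μ
  · refine isBigO_interpError_rightSing H halias hμ hM K hg (by linarith) fun k => ?_
    obtain ⟨m, hm⟩ := hint
    have hm0 : 0 ≤ m := by
      have : -1 < m := by rw [← hm] at hγ1; exact_mod_cast hγ1
      omega
    obtain ⟨p, rfl⟩ := Int.eq_ofNat_of_zero_le hm0
    have hp : γ + k = ((p + k : ℕ) : ℝ) := by rw [← hm]; push_cast; ring
    have h := isBigO_interpError_singPow_natCast H hx (m := p + k) (σ := σ)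
      (by rw [← hp]; linarith [hk k]) (by rw [← hp]; linarith [hk k]) (by
        filter_upwards [hpt' k] with n hn y hy h1 h2
        have := hn y hy h1
        rw [hp, h2, Nat.cast_zero] at this
        exact lt_irrefl _ this) (μ - 1)
    rwa [Nat.sub_add_cancel (Nat.pos_of_ne_zero hμ), ← hp] at h

end Rate

/-- On symmetric nodes, uniqueness makes `p(-X)` the interpolant of `f(-y)` when `p` interpolates
`f`. -/
lemma interpError_comp_neg {v : ℕ → ℝ} {n : ℕ} (hv : InjOn v (Finset.range (n + 1)))
    (hsymm : ∀ j ≤ n, v (n - j) = -v j) (f : ℝ → ℝ) (x : ℝ) :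
    interpError v n (fun y => f (-y)) x = interpError v n f (-x) := by
  set p := Lagrange.interpolate (Finset.range (n + 1)) v (fun j => f (v j)) with hp
  have hdeg : p.natDegree ≤ n := by
    have := Lagrange.degree_interpolate_le (fun j => f (v j)) hv
    rw [Finset.card_range, Nat.add_sub_cancel] at this
    exact Polynomial.natDegree_le_of_degree_le this
  rw [interpError_eq_sub_eval hv (P := p.comp (-Polynomial.X))]
  · simp [interpError, ← hp]
  · rw [Polynomial.natDegree_comp, Polynomial.natDegree_neg, Polynomial.natDegree_X, mul_one]
    exact hdeg
  · intro j hj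
    have hjn : j ≤ n := Nat.lt_succ_iff.1 (Finset.mem_range.1 hj)
    have h := Lagrange.eval_interpolate_at_node (fun j => f (v j)) hv
      (Finset.mem_range.2 (by omega : n - j < n + 1))
    simp only [← hp, hsymm j hjn] at h
    simpa using h

lemma firstNode_sub {n j : ℕ} (hj : j ≤ n) : firstNode n (n - j) = -firstNode n j := by
  rw [firstNode, firstNode, ← Real.cos_pi_sub]
  congr 1
  rw [Nat.cast_sub hj]
  field_simp
  ring

lemma node_sub {n j : ℕ} (hn : 0 < n) (hj : j ≤ n) :
    Polynomial.Chebyshev.node n (n - j) = -Polynomial.Chebyshev.node n j := by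
  have hn0 : (n : ℝ) ≠ 0 := by exact_mod_cast hn.ne'
  rw [Polynomial.Chebyshev.node, Polynomial.Chebyshev.node, ← Real.cos_pi_sub]
  congr 1
  rw [Nat.cast_sub hj]
  field_simp

lemma errorRate_congr {γ x y s : ℝ} {μ : ℕ} {f h : ℝ → ℝ} {p q : ℕ → Polynomial ℝ}
    (H : ErrorRate γ μ f p x s)
    (heq : ∀ᶠ n in atTop, f x - (p n).eval x = h y - (q n).eval y) : ErrorRate γ μ h q y s :=
  ⟨fun hi => (H.1 hi).congr' heq EventuallyEq.rfl, fun hi => (H.2 hi).congr' heq EventuallyEq.rfl⟩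

lemma leftSing_eq (γ : ℝ) (μ : ℕ) (g : ℝ → ℝ) :
    leftSing γ μ g = fun y => rightSing γ μ (fun z => g (-z)) (-y) := by
  funext y
  simp [leftSing, rightSing]

lemma analyticOnNhd_comp_neg {g : ℝ → ℝ} (hg : AnalyticOnNhd ℝ g (Icc (-1) 1)) :
    AnalyticOnNhd ℝ (fun z => g (-z)) (Icc (-1) 1) := fun y hy =>
  AnalyticAt.fun_comp (hg (-y) ⟨by linarith [hy.2], by linarith [hy.1]⟩) analyticAt_id.neg

lemma errorRate_first_leftSing {γ : ℝ} {μ : ℕ} {g : ℝ → ℝ} {x s : ℝ}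
    (h : ErrorRate γ μ (rightSing γ μ fun z => g (-z))
      (firstInterp (rightSing γ μ fun z => g (-z))) (-x) s) :
    ErrorRate γ μ (leftSing γ μ g) (firstInterp (leftSing γ μ g)) x s := by
  refine errorRate_congr h (Eventually.of_forall fun n => ?_)
  rw [leftSing_eq]
  exact (interpError_comp_neg (injOn_firstNode n) (fun j hj => firstNode_sub hj) _ x).symm

lemma errorRate_second_leftSing {γ : ℝ} {μ : ℕ} {g : ℝ → ℝ} {x s : ℝ}
    (h : ErrorRate γ μ (rightSing γ μ fun z => g (-z))
      (secondInterp (rightSing γ μ fun z => g (-z))) (-x) s) :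
    ErrorRate γ μ (leftSing γ μ g) (secondInterp (leftSing γ μ g)) x s := by
  refine errorRate_congr h ?_
  filter_upwards [eventually_gt_atTop 0] with n hn
  rw [leftSing_eq]
  exact (interpError_comp_neg (injOn_node n) (fun j hj => node_sub hn hj) _ x).symm

/-- With `a = b = 0` the method allows any exponent up to `2 γ + 2`, one more than is claimed. -/
lemma errorRate_first_of_lt {γ : ℝ} (hγ : -1 / 2 < γ) {μ : ℕ} (hμ : μ ≠ 0) {g : ℝ → ℝ}
    (hg : AnalyticOnNhd ℝ g (Icc (-1) 1)) {x : ℝ} (hx : x ∈ Ico (-1 : ℝ) 1) :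
    ErrorRate γ μ (rightSing γ μ g) (firstInterp (rightSing γ μ g)) x (2 * γ + 1) := by
  refine errorRate_rightSing (kernelBound_firstNode_of_lt hx) hx.2.le
    (Eventually.of_forall (abs_interpError_T_firstNode_le (Ico_subset_Icc_self hx)))
    (by linarith) (by linarith) (by linarith) (Eventually.of_forall ?_) hμ hg
  rintro n y (rfl | ⟨j, hj, rfl⟩) h
  · exact absurd h hx.2.ne
  · exact absurd h (firstNode_lt_one hj).ne

lemma errorRate_first_one {γ : ℝ} (hγ : 0 < γ) {μ : ℕ} (hμ : μ ≠ 0) {g : ℝ → ℝ}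
    (hg : AnalyticOnNhd ℝ g (Icc (-1) 1)) :
    ErrorRate γ μ (rightSing γ μ g) (firstInterp (rightSing γ μ g)) 1 (2 * γ) :=
  errorRate_rightSing kernelBound_firstNode_one le_rfl
    (Eventually.of_forall (abs_interpError_T_firstNode_le ⟨by norm_num, le_rfl⟩))
    (by linarith) (by linarith) (by linarith) (Eventually.of_forall fun _ _ _ _ => hγ) hμ hg

lemma errorRate_second_of_lt {γ : ℝ} (hγ : 0 < γ) {μ : ℕ} (hμ : μ ≠ 0) {g : ℝ → ℝ}
    (hg : AnalyticOnNhd ℝ g (Icc (-1) 1)) {x : ℝ} (hx : x ∈ Ico (-1 : ℝ) 1) :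
    ErrorRate γ μ (rightSing γ μ g) (secondInterp (rightSing γ μ g)) x (2 * γ + 1) := by
  refine errorRate_rightSing (kernelBound_node hx) hx.2.le ?_
    (by linarith) (by linarith) (by linarith) (Eventually.of_forall fun _ _ _ _ => hγ) hμ hg
  filter_upwards [eventually_gt_atTop 0] with n hn
  exact abs_interpError_T_node_le (Ico_subset_Icc_self hx) hn

/-- The point `1` is node number `0`, so the error is identically zero. -/
lemma errorRate_second_one (γ : ℝ) (μ : ℕ) (f : ℝ → ℝ) (s : ℝ) :
    ErrorRate γ μ f (secondInterp f) 1 s := by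
  have h : (fun n : ℕ => f 1 - (secondInterp f n).eval 1) = fun _ => 0 := by
    funext n
    have := interpError_node (injOn_node n) (Finset.mem_range.2 (Nat.succ_pos n)) f
    rwa [Polynomial.Chebyshev.node_eq_one] at this
  unfold ErrorRate
  rw [h]
  exact ⟨fun _ => Asymptotics.isBigO_zero _ _, fun _ => Asymptotics.isBigO_zero _ _⟩

end

end ChebInterp

theorem mainTheorem4 (γ : ℝ) (hγ : -1 / 2 < γ) (μ : ℕ) (hμ : 1 ≤ μ) (g : ℝ → ℝ)
    (hg : AnalyticOnNhd ℝ g (Set.Icc (-1) 1)) :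
    -- points of the first kind, away from the singular endpoint
    (∀ x ∈ Set.Ico (-1 : ℝ) 1,
      ChebInterp.ErrorRate γ μ (ChebInterp.rightSing γ μ g)
        (ChebInterp.firstInterp (ChebInterp.rightSing γ μ g)) x (2 * γ + 1)) ∧
    (∀ x ∈ Set.Ioc (-1 : ℝ) 1,
      ChebInterp.ErrorRate γ μ (ChebInterp.leftSing γ μ g)
        (ChebInterp.firstInterp (ChebInterp.leftSing γ μ g)) x (2 * γ + 1)) ∧
    -- claims that use the value of the function at the singular endpoint
    (0 < γ →
      -- points of the first kind, at the singular endpoint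
      ChebInterp.ErrorRate γ μ (ChebInterp.rightSing γ μ g)
        (ChebInterp.firstInterp (ChebInterp.rightSing γ μ g)) 1 (2 * γ) ∧
      ChebInterp.ErrorRate γ μ (ChebInterp.leftSing γ μ g)
        (ChebInterp.firstInterp (ChebInterp.leftSing γ μ g)) (-1) (2 * γ) ∧
      -- points of the second kind, away from the singular endpoint
      (∀ x ∈ Set.Ico (-1 : ℝ) 1,
        ChebInterp.ErrorRate γ μ (ChebInterp.rightSing γ μ g)
          (ChebInterp.secondInterp (ChebInterp.rightSing γ μ g)) x (2 * γ + 1)) ∧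
      (∀ x ∈ Set.Ioc (-1 : ℝ) 1,
        ChebInterp.ErrorRate γ μ (ChebInterp.leftSing γ μ g)
          (ChebInterp.secondInterp (ChebInterp.leftSing γ μ g)) x (2 * γ + 1)) ∧
      -- points of the second kind, at the singular endpoint
      ChebInterp.ErrorRate γ μ (ChebInterp.rightSing γ μ g)
        (ChebInterp.secondInterp (ChebInterp.rightSing γ μ g)) 1 (2 * γ) ∧
      ChebInterp.ErrorRate γ μ (ChebInterp.leftSing γ μ g)
        (ChebInterp.secondInterp (ChebInterp.leftSing γ μ g)) (-1) (2 * γ)) := by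
  have hμ0 : μ ≠ 0 := Nat.pos_iff_ne_zero.1 hμ
  have hg' := ChebInterp.analyticOnNhd_comp_neg hg
  have hneg : ∀ x ∈ Set.Ioc (-1 : ℝ) 1, -x ∈ Set.Ico (-1 : ℝ) 1 := fun x hx =>
    ⟨neg_le_neg hx.2, by linarith [hx.1]⟩
  refine ⟨fun x hx => ChebInterp.errorRate_first_of_lt hγ hμ0 hg hx,
    fun x hx => ChebInterp.errorRate_first_leftSing
      (ChebInterp.errorRate_first_of_lt hγ hμ0 hg' (hneg x hx)),
    fun hγ0 => ⟨ChebInterp.errorRate_first_one hγ0 hμ0 hg,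
      ChebInterp.errorRate_first_leftSing ?_,
      fun x hx => ChebInterp.errorRate_second_of_lt hγ0 hμ0 hg hx,
      fun x hx => ChebInterp.errorRate_second_leftSing
        (ChebInterp.errorRate_second_of_lt hγ0 hμ0 hg' (hneg x hx)),
      ChebInterp.errorRate_second_one _ _ _ _,
      ChebInterp.errorRate_second_leftSing ?_⟩⟩
  · rw [neg_neg]
    exact ChebInterp.errorRate_first_one hγ0 hμ0 hg'
  · rw [neg_neg]
    exact ChebInterp.errorRate_second_one _ _ _ _
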